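/- Conventions. All algebras are unital commutative $\mathbb R$-algebras. For such an algebra $B$, $X(B)$ is the set of all unital $\mathbb R$-algebra homomorphisms $B\to\mathbb R$ (characters), endowed with the weakest topology making $\alpha\mapsto\alpha(b)$ continuous for every $b\in B$, and with the corresponding Borel $\sigma$-algebra. A Radon measure on $X(B)$ is a non-negative Borel measure which is locally finite and inner regular with respect to compact sets. It is a representing Radon measure for a linear functional $\ell:B\to\mathbb R$ if for all $b\in B$ the function $\alpha\mapsto\alpha(b)$ is $\nu$-integrable and $\ell(b)=\int_{X(B)}\alpha(b)\,d\nu(\alpha)$. We say that $\nu$ is supported in $C\subseteq X(B)$ if $\nu(X(B)\setminus C)=0$. A quadratic module in $A$ is a set $Q\subseteq A$ with $1\in Q$, $Q+Q\subseteq Q$ and $a^2Q\subseteq Q$ for all $a\in A$; $K_Q=\{\alpha\in X(A):\alpha(a)\ge 0\ \forall a\in Q\}$, and for a subalgebra $S\subseteq A$, $K_{Q\cap S}=\{\alpha\in X(S):\alpha(a)\ge0\ \forall a\in Q\cap S\}$. A seminorm $p$ on a real vector space $V$ is Hilbertian if $p(v)=\sqrt{\langle v,v\rangle_p}$ for a (necessarily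 unique) symmetric positive semidefinite bilinear form $\langle\cdot,\cdot\rangle_p$ on $V$. For Hilbertian seminorms $p,q$ on $V$, the trace of $p$ with respect to $q$ is $\mathrm{tr}(p/q)=\sup_E\sum_{e\in E}p(e)^2\in[0,\infty]$, the supremum over all finite $q$-orthonormal sets $E\subseteq V$ (i.e. $q(e)=1$ for all $e\in E$ and $\langle e,f\rangle_q=0$ for all distinct $e,f\in E$), if $\ker q\subseteq\ker p$, and $\mathrm{tr}(p/q)=\infty$ otherwise. A linear functional $l$ on $V$ is $q$-continuous if there is $C>0$ with $|l(v)|\le C q(v)$ for all $v\in V$. **Theorem.** Let $A$ be an algebra generated by a linear subspace $V\subseteq A$, let $K\subseteq X(A)$ be closed, and let $q$ be a Hilbertian seminorm on $V$ such that $\{\alpha\in K:\alpha|_V\text{ is }q\text{-continuous}\}\ne\emptyset$. Let $J=\{\langle W\rangle: W\text{ a finite dimensional subspace of }V\}$, where $\langle W\rangle$ is the (unital) subalgebra of $A$ generated by $W$. Let $L:A\to\mathbb R$ be linear with $L(1)=1$, and let $Q$ be a quadratic module in $A$ with $K=K_Q$. Then the following are equivalent: 1. there exists a representing Radon measure $\nu$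 for $L$ supported in $\{\alpha\in K:\alpha|_V\text{ is }q\text{-continuous}\}$; 2. there exist a Hilbertian seminorm $p$ on $V$ with $\mathrm{tr}(p/q)<\infty$ and, for each $S\in J$, a representing Radon measure $\nu_S$ for $L|_S$ supported in $K_{Q\cap S}$, such that the family $\{\nu_S:S\in J\}$ is $p$-concentrated, i.e. for every $\varepsilon>0$ there is $\delta>0$ such that $\nu_S(\{\alpha\in X(S):|\alpha(a)|\ge1\})\le\varepsilon$ for all $S\in J$ and all $a\in V\cap S$ with $p(a)\le\delta$. -/

import Mathlib

open MeasureTheory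
open scoped ENNReal

namespace MomentProblem

/-! ### Characters -/

/-- The character space `X(A)`: all unital `ℝ`-algebra homomorphisms from `A` to `ℝ`. -/
def CharSpace (A : Type*) [CommRing A] [Algebra ℝ A] : Type _ := A →ₐ[ℝ] ℝ

instance (A : Type*) [CommRing A] [Algebra ℝ A] : FunLike (CharSpace A) A ℝ :=
  inferInstanceAs (FunLike (A →ₐ[ℝ] ℝ) A ℝ)

instance (A : Type*) [CommRing A] [Algebra ℝ A] : AlgHomClass (CharSpace A) ℝ A ℝ :=
  inferInstanceAs (AlgHomClass (A →ₐ[ℝ] ℝ) ℝ A ℝ)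

/-- The weakest topology on `X(A)` making all evaluations `α ↦ α a` continuous. -/
instance (A : Type*) [CommRing A] [Algebra ℝ A] : TopologicalSpace (CharSpace A) :=
  ⨅ a : A, TopologicalSpace.induced (fun α : CharSpace A => α a) inferInstance

/-- The Borel `σ`-algebra of the weak topology on `X(A)`. -/
instance (A : Type*) [CommRing A] [Algebra ℝ A] : MeasurableSpace (CharSpace A) :=
  borel (CharSpace A)

instance (A : Type*) [CommRing A] [Algebra ℝ A] : BorelSpace (CharSpace A) := ⟨rfl⟩

/-! ### Quadratic modules and their non-negativity sets -/

/-- `Q` is a quadratic module in `A`: `1 ∈ Q`, `Q + Q ⊆ Q` and `A² Q ⊆ Q`. -/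
structure IsQuadraticModule {A : Type*} [CommRing A] (Q : Set A) : Prop where
  one_mem : (1 : A) ∈ Q
  add_mem : ∀ a ∈ Q, ∀ b ∈ Q, a + b ∈ Q
  sq_mul_mem : ∀ a : A, ∀ b ∈ Q, a ^ 2 * b ∈ Q

/-- The non-negativity set `K_Q = {α ∈ X(A) : α(a) ≥ 0 for all a ∈ Q}`. -/
def nonnegSet {A : Type*} [CommRing A] [Algebra ℝ A] (Q : Set A) : Set (CharSpace A) :=
  {α | ∀ a ∈ Q, 0 ≤ α a}

/-! ### Hilbertian seminorms and the trace -/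

/-- A seminorm is Hilbertian if it is induced by a symmetric positive semidefinite bilinear
form. -/
def IsHilbertian {V : Type*} [AddCommGroup V] [Module ℝ V] (p : Seminorm ℝ V) : Prop :=
  ∃ B : V →ₗ[ℝ] V →ₗ[ℝ] ℝ, (∀ v w, B v w = B w v) ∧ (∀ v, 0 ≤ B v v) ∧
    ∀ v, p v = Real.sqrt (B v v)

/-- The form `⟨v, w⟩_p`, recovered from `p` by polarization. -/
noncomputable def polarForm {V : Type*} [AddCommGroup V] [Module ℝ V] (p : Seminorm ℝ V)
    (v w : V) : ℝ :=
  (p (v + w) ^ 2 - p v ^ 2 - p w ^ 2) / 2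

/-- The form inducing a Hilbertian seminorm `p` is `⟨·, ·⟩_p`. -/
theorem polarForm_eq {V : Type*} [AddCommGroup V] [Module ℝ V] (p : Seminorm ℝ V)
    (B : V →ₗ[ℝ] V →ₗ[ℝ] ℝ) (hs : ∀ v w, B v w = B w v) (h0 : ∀ v, 0 ≤ B v v)
    (hp : ∀ v, p v = Real.sqrt (B v v)) (v w : V) : polarForm p v w = B v w := by
  have h : ∀ u, p u ^ 2 = B u u := fun u => by rw [hp, Real.sq_sqrt (h0 u)]
  simp only [polarForm, h, map_add, LinearMap.add_apply, hs w v]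
  ring

/-- `E` is a finite `q`-orthonormal subset of `V`, i.e. `E ∈ FON(q)`. -/
def IsFON {V : Type*} [AddCommGroup V] [Module ℝ V] (q : Seminorm ℝ V) (E : Finset V) : Prop :=
  (∀ e ∈ E, q e = 1) ∧ ∀ e ∈ E, ∀ f ∈ E, e ≠ f → polarForm q e f = 0

open scoped Classical in
/-- The trace `tr(p/q) ∈ [0, ∞]`: the supremum of `∑_{e ∈ E} p(e)²` over all finite
`q`-orthonormal sets `E` if `ker q ⊆ ker p`, and `∞` otherwise. -/
noncomputable def seminormTrace {V : Type*} [AddCommGroup V] [Module ℝ V]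
    (p q : Seminorm ℝ V) : ℝ≥0∞ :=
  if ∀ v, q v = 0 → p v = 0 then
    ⨆ (E : Finset V) (_ : IsFON q E), ∑ e ∈ E, ENNReal.ofReal (p e ^ 2)
  else ∞

/-- The restriction of the character `α` to the subspace `V` is `q`-continuous. -/
def IsContinuousOn {A : Type*} [CommRing A] [Algebra ℝ A] {V : Submodule ℝ A}
    (q : Seminorm ℝ V) (α : CharSpace A) : Prop :=
  ∃ C : ℝ, 0 < C ∧ ∀ v : V, |α (v : A)| ≤ C * q v

/-! ### Representing Radon measures -/

/-- `ν` is a Radon measure on `X(A)` (locally finite, and inner regular on Borel sets with respect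
to compact sets) and represents `L`, i.e. `L(a) = ∫ α(a) dν(α)` for all `a ∈ A`, the integrals
being convergent. -/
structure IsRepresenting {A : Type*} [CommRing A] [Algebra ℝ A] (L : A →ₗ[ℝ] ℝ)
    (ν : Measure (CharSpace A)) : Prop where
  locallyFinite : IsLocallyFiniteMeasure ν
  innerRegular : ν.InnerRegular
  integrable : ∀ a : A, Integrable (fun α : CharSpace A => α a) ν
  eq_integral : ∀ a : A, L a = ∫ α : CharSpace A, α a ∂ν

/-- `ν` is supported in `C`: the complement of `C` is a `ν`-null set. -/
def IsSupportedIn {A : Type*} [CommRing A] [Algebra ℝ A] (ν : Measure (CharSpace A))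
    (C : Set (CharSpace A)) : Prop :=
  ν Cᶜ = 0

/-! ### Finitely generated subalgebras and concentration -/

/-- The family `J` of the subalgebras `⟨W⟩` generated by the finite dimensional subspaces `W`
of `V`. -/
def finGenSubalgebras {A : Type*} [CommRing A] [Algebra ℝ A] (V : Submodule ℝ A) :
    Set (Subalgebra ℝ A) :=
  {S | ∃ W : Submodule ℝ A, W ≤ V ∧ FiniteDimensional ℝ W ∧ S = Algebra.adjoin ℝ (W : Set A)}

/-- The family `(ν_S)_{S ∈ J}` is `p`-concentrated: for every `ε > 0` there is `δ > 0` such that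
`ν_S({α ∈ X(S) : |α(a)| ≥ 1}) ≤ ε` for all `S ∈ J` and all `a ∈ V ∩ S` with `p(a) ≤ δ`. -/
def IsConcentrated {A : Type*} [CommRing A] [Algebra ℝ A] {V : Submodule ℝ A}
    (p : Seminorm ℝ V)
    (ν : ∀ S : finGenSubalgebras V, Measure (CharSpace (S : Subalgebra ℝ A))) : Prop :=
  ∀ ε : ℝ, 0 < ε → ∃ δ : ℝ, 0 < δ ∧ ∀ S : finGenSubalgebras V, ∀ a : V, p a ≤ δ →
    ∀ ha : (a : A) ∈ (S : Subalgebra ℝ A),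
      ν S {α : CharSpace (S : Subalgebra ℝ A) | 1 ≤ |α ⟨(a : A), ha⟩|} ≤ ENNReal.ofReal ε

end MomentProblem

namespace MomentProblem

open Filter Topology

/-! ### Random signs -/

theorem exists_random_signs {W : Type*} [AddCommGroup W] [Module ℝ W] (E : Finset W) :
    ∃ (κ : Type) (_ : Fintype κ) (_ : Nonempty κ) (w : κ → W),
      (∀ B : W →ₗ[ℝ] W →ₗ[ℝ] ℝ,
        ∑ k, B (w k) (w k) = Fintype.card κ * ∑ e ∈ E, B e e) ∧
      ∀ f : W →ₗ[ℝ] ℝ,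
        ∑ k, f (w k) ^ 4 ≤ Fintype.card κ * (3 * (∑ e ∈ E, f e ^ 2) ^ 2) := by
  classical
  induction E using Finset.induction_on with
  | empty => exact ⟨Unit, inferInstance, inferInstance, fun _ => 0, by simp, by simp⟩
  | insert e E he ih =>
    obtain ⟨κ, _, _, w, h2, h4⟩ := ih
    refine ⟨κ ⊕ κ, inferInstance, inferInstance,
      Sum.elim (fun k => w k + e) (fun k => w k - e), fun B => ?_, fun f => ?_⟩
    · have : ∀ k, B (w k + e) (w k + e) + B (w k - e) (w k - e) =
          2 * B (w k) (w k) + 2 * B e e := fun k => by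
        simp only [map_add, map_sub, LinearMap.add_apply, LinearMap.sub_apply]; ring
      simp only [Fintype.sum_sum_type, Sum.elim_inl, Sum.elim_inr, ← Finset.sum_add_distrib, this,
        Fintype.card_sum, Finset.sum_insert he]
      rw [Finset.sum_add_distrib, ← Finset.mul_sum, h2 B]
      simp
      ring
    · have hf2 : ∑ k, f (w k) ^ 2 = Fintype.card κ * ∑ e ∈ E, f e ^ 2 := by
        simpa [pow_two] using h2 ((LinearMap.mul ℝ ℝ).compl₁₂ f f)
      have : ∀ k, f (w k + e) ^ 4 + f (w k - e) ^ 4 =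
          2 * f (w k) ^ 4 + 12 * f e ^ 2 * f (w k) ^ 2 + 2 * f e ^ 4 := fun k => by
        simp only [map_add, map_sub]; ring
      simp only [Fintype.sum_sum_type, Sum.elim_inl, Sum.elim_inr, ← Finset.sum_add_distrib, this,
        Fintype.card_sum, Finset.sum_insert he]
      rw [Finset.sum_add_distrib, Finset.sum_add_distrib, ← Finset.mul_sum, ← Finset.mul_sum, hf2]
      simp only [Finset.sum_const, Finset.card_univ, nsmul_eq_mul, Nat.cast_add]
      have hc : (0 : ℝ) ≤ Fintype.card κ * f e ^ 4 := by positivity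
      nlinarith [h4 f]

/-- A Paley–Zygmund inequality for finite averages. -/
theorem card_le_card_filter_of_sum_sq {κ : Type*} [Fintype κ] (y : κ → ℝ)
    {s : ℝ} (hs : 0 < s) (h1 : ∑ k, y k = Fintype.card κ * s)
    (h2 : ∑ k, y k ^ 2 ≤ Fintype.card κ * (3 * s ^ 2)) :
    (3 / 20 : ℝ) * Fintype.card κ ≤ ∑ k, if s / 4 ≤ y k then (1 : ℝ) else 0 := by
  have key : ∀ k, y k * s - y k ^ 2 / 5 - s ^ 2 / 4 ≤
      s ^ 2 * if s / 4 ≤ y k then (1 : ℝ) else 0 := by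
    intro k
    split_ifs with h
    · nlinarith [sq_nonneg (y k - 5 / 2 * s)]
    · nlinarith [sq_nonneg (y k)]
  have := Finset.sum_le_sum fun k (_ : k ∈ Finset.univ) => key k
  rw [← Finset.mul_sum, Finset.sum_sub_distrib, Finset.sum_sub_distrib, ← Finset.sum_mul, h1,
    ← Finset.sum_div] at this
  simp only [Finset.sum_const, Finset.card_univ, nsmul_eq_mul] at this
  have hs2 : 0 < s ^ 2 := by positivity
  refine le_of_mul_le_mul_left ?_ hs2
  nlinarith

/-! ### Orthonormal systems of semidefinite forms -/

/-- `E` is orthonormal for the bilinear form `B`. -/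
def IsON {W : Type*} [AddCommGroup W] [Module ℝ W] (B : W →ₗ[ℝ] W →ₗ[ℝ] ℝ) (E : Finset W) :
    Prop :=
  (∀ e ∈ E, B e e = 1) ∧ ∀ e ∈ E, ∀ f ∈ E, e ≠ f → B e f = 0

section Form

variable {W : Type*} [AddCommGroup W] [Module ℝ W] {B : W →ₗ[ℝ] W →ₗ[ℝ] ℝ}

theorem IsON.apply_sum_smul {E : Finset W} (hE : IsON B E) (c : W → ℝ) {e : W} (he : e ∈ E) :
    B e (∑ f ∈ E, c f • f) = c e := by
  rw [map_sum, Finset.sum_eq_single e]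
  · simp [hE.1 e he]
  · intro f hf hfe
    simp [hE.2 e he f hf hfe.symm]
  · exact fun h => absurd he h

theorem IsON.apply_sum_smul_sum_smul {E : Finset W} (hE : IsON B E) (c : W → ℝ) :
    B (∑ f ∈ E, c f • f) (∑ f ∈ E, c f • f) = ∑ f ∈ E, c f ^ 2 := by
  rw [map_sum B, LinearMap.sum_apply]
  refine Finset.sum_congr rfl fun e he => ?_
  rw [map_smul, LinearMap.smul_apply, hE.apply_sum_smul c he, smul_eq_mul, sq]

/-- Bessel's inequality. -/
theorem IsON.sum_sq_le (hs : ∀ v w, B v w = B w v) (h0 : ∀ v, 0 ≤ B v v) {E : Finset W}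
    (hE : IsON B E) (v : W) : ∑ e ∈ E, B e v ^ 2 ≤ B v v := by
  have h := h0 (v - ∑ e ∈ E, B e v • e)
  have h1 : B (∑ e ∈ E, B e v • e) v = ∑ e ∈ E, B e v ^ 2 := by
    rw [map_sum, LinearMap.sum_apply]
    exact Finset.sum_congr rfl fun e _ => by simp [sq]
  simp only [map_sub, LinearMap.sub_apply] at h
  rw [hE.apply_sum_smul_sum_smul, hs v (∑ e ∈ E, B e v • e), h1] at h
  linarith

theorem IsON.apply_sub_eq_zero {E : Finset W} (hE : IsON B E) (v : W) {e : W} (he : e ∈ E) :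
    B e (v - ∑ f ∈ E, B f v • f) = 0 := by
  rw [map_sub, hE.apply_sum_smul (fun f => B f v) he, sub_self]

/-- Gram–Schmidt orthonormalization modulo the kernel of a semidefinite form. -/
theorem exists_isON (hs : ∀ v w, B v w = B w v) (h0 : ∀ v, 0 ≤ B v v) (t : Finset W) :
    ∃ E : Finset W, IsON B E ∧ ∀ u ∈ t,
      B (u - ∑ e ∈ E, B e u • e) (u - ∑ e ∈ E, B e u • e) = 0 := by
  classical
  induction t using Finset.induction_on with
  | empty => exact ⟨∅, by simp [IsON], by simp⟩
  | insert u t hu ih =>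
    obtain ⟨E, hE, hz⟩ := ih
    set z := u - ∑ e ∈ E, B e u • e with hzdef
    have hBz : ∀ e ∈ E, B e z = 0 := fun e he => hE.apply_sub_eq_zero u he
    rcases (h0 z).eq_or_lt with h | h
    · refine ⟨E, hE, fun v hv => ?_⟩
      rcases Finset.mem_insert.1 hv with rfl | hv
      · exact h.symm
      · exact hz v hv
    have hr : 0 < Real.sqrt (B z z) := Real.sqrt_pos.2 h
    set e₀ := (Real.sqrt (B z z))⁻¹ • z with he₀
    have h00 : B e₀ e₀ = 1 := by
      simp only [he₀, map_smul, LinearMap.smul_apply, smul_eq_mul]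
      rw [← mul_assoc, ← mul_inv, Real.mul_self_sqrt h.le, inv_mul_cancel₀ h.ne']
    have h0e : ∀ e ∈ E, B e e₀ = 0 := fun e he => by simp [he₀, hBz e he]
    have hnot : e₀ ∉ E := fun hmem => by
      have := h0e e₀ hmem
      rw [h00] at this
      exact one_ne_zero this
    have hE' : IsON B (insert e₀ E) := by
      refine ⟨fun e he => ?_, fun e he f hf hef => ?_⟩
      · rcases Finset.mem_insert.1 he with rfl | he
        exacts [h00, hE.1 e he]
      · rcases Finset.mem_insert.1 he with rfl | he <;> rcases Finset.mem_insert.1 hf with rfl | hf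
        · exact absurd rfl hef
        · rw [hs]; exact h0e f hf
        · exact h0e e he
        · exact hE.2 e he f hf hef
    refine ⟨insert e₀ E, hE', fun v hv => ?_⟩
    have step : ∀ v, v - ∑ e ∈ insert e₀ E, B e v • e =
        (v - ∑ e ∈ E, B e v • e) - B e₀ (v - ∑ e ∈ E, B e v • e) • e₀ := fun v => by
      have : B e₀ (∑ e ∈ E, B e v • e) = 0 := by
        rw [map_sum]
        refine Finset.sum_eq_zero fun e he => ?_
        rw [map_smul, hs e₀, h0e e he, smul_zero]
      rw [Finset.sum_insert hnot, map_sub, this, sub_zero]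
      abel
    have hproj : ∀ x, B (x - B e₀ x • e₀) (x - B e₀ x • e₀) = B x x - B e₀ x ^ 2 := fun x => by
      simp only [map_sub, map_smul, LinearMap.sub_apply, LinearMap.smul_apply, smul_eq_mul, h00,
        hs x e₀]
      ring
    rw [step, hproj]
    rcases Finset.mem_insert.1 hv with rfl | hv
    · rw [← hzdef]
      have : B e₀ z = Real.sqrt (B z z) := by
        simp only [he₀, map_smul, LinearMap.smul_apply, smul_eq_mul]
        rw [inv_mul_eq_div, Real.div_sqrt]
      rw [this, Real.sq_sqrt h.le, sub_self]
    · refine le_antisymm ?_ ?_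
      · rw [hz v hv]; nlinarith [sq_nonneg (B e₀ (v - ∑ e ∈ E, B e v • e))]
      · rw [← hproj]; exact h0 _

end Form

/-! ### The Minlos estimate -/

/-- If a random linear functional `X` on a finite dimensional space is concentrated with respect
to a form `Bp` of trace at most `T` relative to `Bq`, then its `Bq`-norm is rarely large. -/
theorem measure_exists_lt_le {Ω W : Type*} [MeasurableSpace Ω] (m : Measure Ω)
    [IsProbabilityMeasure m] [AddCommGroup W] [Module ℝ W] [FiniteDimensional ℝ W]
    {Bq Bp : W →ₗ[ℝ] W →ₗ[ℝ] ℝ} (hsq : ∀ v w, Bq v w = Bq w v) (hq : ∀ v, 0 ≤ Bq v v)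
    (hp : ∀ v, 0 ≤ Bp v v) {T : ℝ} (hT : ∀ E : Finset W, IsON Bq E → ∑ e ∈ E, Bp e e ≤ T)
    {X : Ω → W →ₗ[ℝ] ℝ} (hX : ∀ w, Measurable fun ω => X ω w)
    (hnull : ∀ z, Bq z z = 0 → ∀ᵐ ω ∂m, X ω z = 0) {ε δ n : ℝ} (hε : 0 ≤ ε) (hδ : 0 < δ)
    (hn : 0 < n) (hconc : ∀ w, Bp w w ≤ δ ^ 2 → m {ω | 1 ≤ |X ω w|} ≤ ENNReal.ofReal ε) :
    m {ω | ∃ v, n * Real.sqrt (Bq v v) < |X ω v|} ≤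
      ENNReal.ofReal (20 / 3 * (ε + 4 * T / (δ ^ 2 * n ^ 2))) := by
  classical
  obtain ⟨t, ht⟩ := Module.Finite.fg_top (R := ℝ) (M := W)
  obtain ⟨E, hE, hz⟩ := exists_isON hsq hq t
  obtain ⟨κ, _, _, w, h2, h4⟩ := exists_random_signs E
  set A : κ → Set Ω := fun k => {ω | 1 ≤ |X ω ((2 / n) • w k)|} with hA
  have hAm : ∀ k, MeasurableSet (A k) := fun k =>
    measurableSet_le measurable_const (hX _).abs
  set h : Ω → ℝ≥0∞ := fun ω => ∑ k, (A k).indicator (fun _ => 1) ω with hh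
  have hc : (0 : ℝ) < Fintype.card κ := by exact_mod_cast Fintype.card_pos
  set c : ℝ := 3 / 20 * Fintype.card κ with hcdef
  have hcpos : 0 < c := by positivity
  set T' : ℝ := ∑ e ∈ E, Bp e e with hT'
  have hAk : ∀ k, m (A k) ≤ ENNReal.ofReal (ε + 4 / (δ ^ 2 * n ^ 2) * Bp (w k) (w k)) := by
    intro k
    by_cases hk : Bp ((2 / n) • w k) ((2 / n) • w k) ≤ δ ^ 2
    · refine (hconc _ hk).trans (ENNReal.ofReal_le_ofReal ?_)
      have := hp (w k)
      have : 0 ≤ 4 / (δ ^ 2 * n ^ 2) * Bp (w k) (w k) := by positivity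
      linarith
    · refine prob_le_one.trans ?_
      rw [← ENNReal.ofReal_one]
      refine ENNReal.ofReal_le_ofReal ?_
      simp only [map_smul, LinearMap.smul_apply, smul_eq_mul, not_le] at hk
      have h1 : 4 / (δ ^ 2 * n ^ 2) * Bp (w k) (w k) =
          (2 / n * (2 / n * Bp (w k) (w k))) / δ ^ 2 := by field_simp; ring
      have h2 : 1 ≤ (2 / n * (2 / n * Bp (w k) (w k))) / δ ^ 2 := by
        rw [one_le_div (by positivity)]; exact hk.le
      linarith
  have hint : ∫⁻ ω, h ω ∂m ≤
      ENNReal.ofReal (Fintype.card κ * (ε + 4 * T / (δ ^ 2 * n ^ 2))) := by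
    rw [hh, lintegral_finsetSum _ fun k _ => measurable_const.indicator (hAm k)]
    simp only [lintegral_indicator_const (hAm _), one_mul]
    refine (Finset.sum_le_sum fun k _ => hAk k).trans ?_
    rw [← ENNReal.ofReal_sum_of_nonneg fun k _ => by have := hp (w k); positivity]
    refine ENNReal.ofReal_le_ofReal ?_
    rw [Finset.sum_add_distrib, ← Finset.mul_sum, h2 Bp, ← hT']
    simp only [Finset.sum_const, Finset.card_univ, nsmul_eq_mul]
    have h1 : T' ≤ T := hT E hE
    have h3 : 4 / (δ ^ 2 * n ^ 2) * (Fintype.card κ * T') ≤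
        4 / (δ ^ 2 * n ^ 2) * (Fintype.card κ * T) := by gcongr
    have h4 : 4 / (δ ^ 2 * n ^ 2) * (Fintype.card κ * T) =
      Fintype.card κ * (4 * T / (δ ^ 2 * n ^ 2)) := by ring
    rw [mul_add]
    linarith
  have hmarkov : m {ω | ENNReal.ofReal c ≤ h ω} ≤
      ENNReal.ofReal (20 / 3 * (ε + 4 * T / (δ ^ 2 * n ^ 2))) := by
    have h1 := (mul_meas_ge_le_lintegral (μ := m) (f := h)
      (Finset.measurable_fun_sum _ fun k _ => measurable_const.indicator (hAm k))
      (ENNReal.ofReal c)).trans hint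
    rw [mul_comm, ← ENNReal.le_div_iff_mul_le (Or.inl (by simpa using hcpos))
      (Or.inl ENNReal.ofReal_ne_top), ← ENNReal.ofReal_div_of_pos hcpos] at h1
    refine h1.trans (ENNReal.ofReal_le_ofReal (le_of_eq ?_))
    rw [hcdef]
    field_simp
  refine le_trans (measure_mono_ae ?_) hmarkov
  have hae : ∀ᵐ ω ∂m, ∀ u ∈ t, X ω (u - ∑ e ∈ E, Bq e u • e) = 0 :=
    (Finset.eventually_all t).2 fun u hu => hnull _ (hz u hu)
  filter_upwards [hae] with ω hω hbad
  obtain ⟨v, hv⟩ := hbad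
  have hlin : ∀ v, X ω v = ∑ e ∈ E, Bq e v * X ω e := by
    have : X ω = ∑ e ∈ E, (X ω e) • Bq e := by
      refine LinearMap.ext_on ht fun u hu => ?_
      have := hω u hu
      rw [map_sub, sub_eq_zero, map_sum] at this
      simpa [mul_comm] using this
    intro v
    conv_lhs => rw [this]
    simp [mul_comm]
  set s : ℝ := ∑ e ∈ E, X ω e ^ 2 with hs
  have hs0 : 0 ≤ s := Finset.sum_nonneg fun e _ => sq_nonneg _
  have hns : n ^ 2 < s := by
    have h1 : X ω v ^ 2 ≤ Bq v v * s := by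
      rw [hlin v]
      refine (Finset.sum_mul_sq_le_sq_mul_sq _ _ _).trans ?_
      exact mul_le_mul_of_nonneg_right (hE.sum_sq_le hsq hq v) hs0
    have h2 : (n * Real.sqrt (Bq v v)) ^ 2 < X ω v ^ 2 := by
      rw [← sq_abs (X ω v)]
      exact pow_lt_pow_left₀ hv (by positivity) two_ne_zero
    rw [mul_pow, Real.sq_sqrt (hq v)] at h2
    by_contra hcon
    have := mul_le_mul_of_nonneg_left (not_lt.1 hcon) (hq v)
    linarith
  have hspos : 0 < s := lt_of_le_of_lt (sq_nonneg n) hns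
  have hcount := card_le_card_filter_of_sum_sq (fun k => X ω (w k) ^ 2) hspos
    (by simpa [pow_two, hs] using h2 ((LinearMap.mul ℝ ℝ).compl₁₂ (X ω) (X ω)))
    (by simpa only [← pow_mul] using h4 (X ω))
  change ENNReal.ofReal c ≤ h ω
  refine (ENNReal.ofReal_le_ofReal hcount).trans ?_
  rw [ENNReal.ofReal_sum_of_nonneg fun k _ => by split_ifs <;> norm_num]
  refine Finset.sum_le_sum fun k _ => ?_
  split_ifs with hk
  · have : ω ∈ A k := by
      simp only [hA, Set.mem_ofPred_eq, map_smul, smul_eq_mul, abs_mul]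
      rw [abs_of_pos (by positivity : 0 < 2 / n), div_mul_eq_mul_div, one_le_div hn]
      have : (n / 2) ^ 2 ≤ X ω (w k) ^ 2 := by nlinarith
      have := sq_le_sq.1 this
      rw [abs_of_pos (by positivity : 0 < n / 2)] at this
      linarith
    simp [this]
  · simp

/-! ### The topology of the character space -/

section CharSpace

variable {A B : Type*} [CommRing A] [Algebra ℝ A] [CommRing B] [Algebra ℝ B]

theorem CharSpace.ext {α β : CharSpace A} (h : ∀ a, α a = β a) : α = β :=
  DFunLike.ext _ _ h

theorem CharSpace.continuous_eval (a : A) : Continuous fun α : CharSpace A => α a :=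
  continuous_iInf_dom (i := a) continuous_induced_dom

theorem CharSpace.continuous_iff {X : Type*} [TopologicalSpace X] {f : X → CharSpace A} :
    Continuous f ↔ ∀ a, Continuous fun x => f x a := by
  refine ⟨fun h a => (continuous_eval a).comp h, fun h => ?_⟩
  exact continuous_iInf_rng.2 fun a => continuous_induced_rng.2 (h a)

instance : T2Space (CharSpace A) :=
  T2Space.of_injective_continuous (f := fun (α : CharSpace A) (a : A) => α a)
    (fun _ _ h => CharSpace.ext fun a => congrFun h a)
    (continuous_pi fun a => CharSpace.continuous_eval a)

/-- Composition of characters with an algebra homomorphism. -/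
def CharSpace.comp (φ : B →ₐ[ℝ] A) (α : CharSpace A) : CharSpace B :=
  AlgHom.comp (show A →ₐ[ℝ] ℝ from α) φ

@[simp]
theorem CharSpace.comp_apply (φ : B →ₐ[ℝ] A) (α : CharSpace A) (b : B) :
    CharSpace.comp φ α b = α (φ b) := rfl

theorem CharSpace.continuous_comp (φ : B →ₐ[ℝ] A) : Continuous (CharSpace.comp φ) :=
  CharSpace.continuous_iff.2 fun b => CharSpace.continuous_eval (φ b)

theorem CharSpace.mem_range_comp {φ : B →ₐ[ℝ] A} (hφ : Function.Surjective φ) {β : CharSpace B}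
    (hβ : ∀ b, φ b = 0 → β b = 0) : β ∈ Set.range (CharSpace.comp φ) := by
  have hw : ∀ b c, φ b = φ c → β b = β c := fun b c h => by
    have := hβ (b - c) (by rw [map_sub, h, sub_self])
    rwa [map_sub, sub_eq_zero] at this
  let g := Function.surjInv hφ
  have hg : ∀ a, φ (g a) = a := Function.surjInv_eq hφ
  let α : A →ₐ[ℝ] ℝ :=
    { toFun := fun a => β (g a)
      map_one' := by rw [hw (g 1) 1 (by rw [hg, map_one]), map_one]
      map_zero' := by rw [hw (g 0) 0 (by rw [hg, map_zero]), map_zero]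
      map_mul' := fun a b => by
        rw [hw (g (a * b)) (g a * g b) (by rw [hg, map_mul, hg, hg]), map_mul]
      map_add' := fun a b => by
        rw [hw (g (a + b)) (g a + g b) (by rw [hg, map_add, hg, hg]), map_add]
      commutes' := fun r => by
        rw [hw (g (algebraMap ℝ A r)) (algebraMap ℝ B r) (by rw [hg, AlgHom.commutes]),
          AlgHomClass.commutes] }
  exact ⟨α, CharSpace.ext fun b => hw _ _ (hg _)⟩

theorem CharSpace.isClosedEmbedding_comp {φ : B →ₐ[ℝ] A} (hφ : Function.Surjective φ) :
    IsClosedEmbedding (CharSpace.comp φ) := by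
  refine ⟨⟨⟨le_antisymm (CharSpace.continuous_comp φ).le_induced ?_⟩, fun α α' h => ?_⟩, ?_⟩
  · refine le_iInf fun a => ?_
    obtain ⟨b, rfl⟩ := hφ a
    refine (induced_iInf.le.trans (iInf_le _ b)).trans ?_
    rw [induced_compose]
    exact le_rfl
  · refine CharSpace.ext fun a => ?_
    obtain ⟨b, rfl⟩ := hφ a
    exact congrArg (fun β : CharSpace B => β b) h
  · have : Set.range (CharSpace.comp φ) = ⋂ b ∈ {b | φ b = 0}, {β : CharSpace B | β b = 0} := by
      ext β
      simp only [Set.mem_iInter]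
      refine ⟨?_, fun h => CharSpace.mem_range_comp hφ h⟩
      rintro ⟨α, rfl⟩ b hb
      change α (φ b) = 0
      rw [show φ b = 0 from hb, map_zero]
    rw [this]
    exact isClosed_biInter fun b _ => isClosed_eq (CharSpace.continuous_eval b) continuous_const

theorem isClosed_nonnegSet (Q : Set A) : IsClosed (nonnegSet Q) := by
  have : nonnegSet Q = ⋂ a ∈ Q, {α : CharSpace A | 0 ≤ α a} := by
    ext α
    simp only [Set.mem_iInter]
    rfl
  rw [this]
  exact isClosed_biInter fun a _ => isClosed_le continuous_const (CharSpace.continuous_eval a)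

end CharSpace

/-! ### Inner regular measures -/

section InnerRegular

variable {E F : Type*} [TopologicalSpace E] [MeasurableSpace E] [BorelSpace E]
  [TopologicalSpace F] [MeasurableSpace F] [BorelSpace F]

theorem innerRegular_comap_of_isClosedEmbedding {f : E → F} (hf : IsClosedEmbedding f)
    (μ : Measure F) [μ.InnerRegular] : (μ.comap f).InnerRegular := by
  have hme := hf.measurableEmbedding
  refine ⟨fun s hs r hr => ?_⟩
  rw [hme.comap_apply] at hr
  obtain ⟨C, hCs, hC, hrC⟩ :=
    (hme.measurableSet_image.2 hs).exists_lt_isCompact (μ := μ) hr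
  refine ⟨f ⁻¹' C, ?_, hf.isCompact_preimage hC, ?_⟩
  · intro x hx
    obtain ⟨y, hy, hxy⟩ := hCs hx
    exact hf.injective hxy ▸ hy
  · rw [hme.comap_apply, Set.image_preimage_eq_of_subset (hCs.trans (Set.image_subset_range _ _))]
    exact hrC

theorem measure_iUnion_eq_zero_of_innerRegular {ι : Type*} (μ : Measure E) [μ.InnerRegular]
    {U : ι → Set E} (hU : ∀ i, IsOpen (U i)) (h0 : ∀ i, μ (U i) = 0) : μ (⋃ i, U i) = 0 := by
  by_contra hne
  obtain ⟨C, hCs, hC, hpos⟩ :=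
    (isOpen_iUnion hU).measurableSet.exists_lt_isCompact (μ := μ) (pos_iff_ne_zero.2 hne)
  obtain ⟨t, ht⟩ := hC.elim_finite_subcover U hU hCs
  refine hpos.ne' (measure_mono_null ht ?_)
  exact (measure_biUnion_null_iff t.countable_toSet).2 fun i _ => h0 i

/-- A finite measure carried by a `σ`-compact set can be replaced by an inner regular one with the
same integrals of bounded continuous functions. -/
theorem exists_innerRegular_integral_eq [T2Space E] (μ : Measure E) [IsFiniteMeasure μ]
    {C : ℕ → Set E} (hC : ∀ n, IsCompact (C n)) (hμ : μ (⋃ n, C n)ᶜ = 0) :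
    ∃ ν : Measure E, ν.InnerRegular ∧ IsFiniteMeasure ν ∧ ν (⋃ n, C n)ᶜ = 0 ∧
      ∀ g : BoundedContinuousFunction E ℝ, ∫ x, g x ∂ν = ∫ x, g x ∂μ := by
  have hCm : ∀ n, MeasurableSet (C n) := fun n => (hC n).isClosed.measurableSet
  have hDm : ∀ n, MeasurableSet (disjointed C n) := MeasurableSet.disjointed hCm
  have h1 : ∀ n, (μ.restrict (disjointed C n)) (C n)ᶜ = 0 := fun n => by
    rw [Measure.restrict_apply (hCm n).compl]
    have : (C n)ᶜ ∩ disjointed C n = ∅ := by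
      ext x
      simp only [Set.mem_inter_iff, Set.mem_compl_iff, Set.mem_empty_iff_false, iff_false, not_and]
      exact fun hx hx' => hx (disjointed_subset C n hx')
    rw [this, measure_empty]
  choose ν hν1 hν2 hν3 hν4 using fun n =>
    Measure.exists_innerRegular_eq_of_isCompact (μ.restrict (disjointed C n)) (hC n) (h1 n)
  have hsum : Measure.sum (fun n => μ.restrict (disjointed C n)) = μ := by
    rw [← Measure.restrict_iUnion (disjoint_disjointed C) hDm, iUnion_disjointed]
    exact Measure.restrict_eq_self_of_ae_mem (mem_ae_iff.2 hμ)
  have hmass : ∀ n, ν n Set.univ = μ.restrict (disjointed C n) Set.univ := fun n => by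
    have := hν4 n (BoundedContinuousFunction.const E 1)
    simp only [BoundedContinuousFunction.const_apply, integral_const, smul_eq_mul, mul_one] at this
    exact ((measureReal_eq_measureReal_iff).1 this).symm
  have hfin : IsFiniteMeasure (Measure.sum ν) := by
    refine ⟨?_⟩
    rw [Measure.sum_apply _ MeasurableSet.univ]
    simp only [hmass]
    rw [← Measure.sum_apply _ MeasurableSet.univ, hsum]
    exact measure_lt_top _ _
  refine ⟨Measure.sum ν, inferInstance, hfin, ?_, fun g => ?_⟩
  · rw [Measure.sum_apply _ (MeasurableSet.iUnion hCm).compl, ENNReal.tsum_eq_zero]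
    exact fun n => measure_mono_null
      (Set.compl_subset_compl.2 (Set.subset_iUnion C n)) (hν3 n)
  · have ha := hasSum_integral_measure (μ := ν) (f := g) (g.integrable _)
    have hb := hasSum_integral_measure (μ := fun n => μ.restrict (disjointed C n)) (f := g)
      (by rw [hsum]; exact g.integrable _)
    rw [hsum] at hb
    simp only [← hν4] at ha
    exact ha.unique hb

end InnerRegular

/-! ### Limits of uniformly tight families -/

section Limit

variable {E : Type*} [TopologicalSpace E] [MeasurableSpace E] [BorelSpace E] {ι : Type*}

theorem exists_innerRegular_tendsto [T2Space E] (U : Ultrafilter ι) (μ : ι → Measure E)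
    [∀ i, IsProbabilityMeasure (μ i)] {C : ℕ → Set E} (hC : ∀ n, IsCompact (C n))
    (hmono : Monotone C) (htight : ∀ η : ℝ≥0∞, 0 < η → ∃ n, ∀ i, μ i (C n)ᶜ ≤ η) :
    ∃ ν : Measure E, ν.InnerRegular ∧ IsFiniteMeasure ν ∧ ν (⋃ n, C n)ᶜ = 0 ∧
      ∀ g : BoundedContinuousFunction E ℝ,
        Tendsto (fun i => ∫ x, g x ∂(μ i)) U (𝓝 (∫ x, g x ∂ν)) := by
  set u : ℕ → ℝ≥0∞ := fun n => ⨆ i, μ i (C n)ᶜ with hu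
  have hu1 : ∀ n, u n ≠ ∞ := fun n =>
    ne_top_of_le_ne_top ENNReal.one_ne_top (iSup_le fun i => prob_le_one)
  have hu0 : Tendsto u atTop (𝓝 0) := by
    rw [ENNReal.tendsto_atTop_zero]
    intro η hη
    obtain ⟨n, hn⟩ := htight η hη
    exact ⟨n, fun k hk => iSup_le fun i =>
      (measure_mono (Set.compl_subset_compl.2 (hmono hk))).trans (hn i)⟩
  have hu0' : Tendsto (fun n => (u n).toNNReal) atTop (𝓝 0) := by
    have := (ENNReal.tendsto_toNNReal ENNReal.zero_ne_top).comp hu0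
    simpa [Function.comp_def] using this
  have hcomp := isCompact_setOfPred_probabilityMeasure_mass_eq_compl_isCompact_le hu0' hC
    (Or.inr hmono)
  let P : ι → ProbabilityMeasure E := fun i => ⟨μ i, inferInstance⟩
  have hP : ∀ i n, (P i) (C n)ᶜ ≤ (u n).toNNReal := fun i n => by
    rw [← ENNReal.coe_le_coe, ProbabilityMeasure.ennreal_coeFn_eq_coeFn_toMeasure,
      ENNReal.coe_toNNReal (hu1 n)]
    exact le_iSup (fun i => μ i (C n)ᶜ) i
  obtain ⟨m, hm, hlim⟩ := hcomp.ultrafilter_le_nhds' (U.map P)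
    (show ∀ᶠ i in (U : Filter ι), ∀ n, (P i) (C n)ᶜ ≤ (u n).toNNReal from
      Eventually.of_forall hP)
  have hm0 : (m : Measure E) (⋃ n, C n)ᶜ = 0 := by
    refine le_antisymm (ge_of_tendsto' hu0 fun n => ?_) zero_le
    refine (measure_mono (Set.compl_subset_compl.2 (Set.subset_iUnion C n))).trans ?_
    rw [← ProbabilityMeasure.ennreal_coeFn_eq_coeFn_toMeasure, ← ENNReal.coe_toNNReal (hu1 n)]
    exact ENNReal.coe_le_coe.2 (hm n)
  obtain ⟨ν, h1, h2, h3, h4⟩ := exists_innerRegular_integral_eq (m : Measure E) hC hm0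
  refine ⟨ν, h1, h2, h3, fun g => ?_⟩
  rw [h4]
  exact ProbabilityMeasure.tendsto_iff_forall_integral_tendsto.1
    (show Tendsto P U (𝓝 m) from hlim) g

variable {l : Filter ι} [l.NeBot] {μ : ι → Measure E} {ν : Measure E}

theorem measure_lt_zero_of_tendsto [IsFiniteMeasure ν]
    (hlim : ∀ g : BoundedContinuousFunction E ℝ,
      Tendsto (fun i => ∫ x, g x ∂(μ i)) l (𝓝 (∫ x, g x ∂ν)))
    {F : E → ℝ} (hF : Continuous F) (h0 : ∀ᶠ i in l, ∀ᵐ x ∂(μ i), 0 ≤ F x) :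
    ν {x | F x < 0} = 0 := by
  let g : BoundedContinuousFunction E ℝ := BoundedContinuousFunction.mkOfBound
    ⟨fun x => max 0 (min 1 (-F x)), by fun_prop⟩ 1 fun x y => by
      rw [Real.dist_eq, abs_le]
      simp only [ContinuousMap.coe_mk]
      have h1 : ∀ x, max 0 (min 1 (-F x)) ≤ 1 := fun x => max_le zero_le_one (min_le_left _ _)
      have h2 : ∀ x, 0 ≤ max 0 (min 1 (-F x)) := fun x => le_max_left _ _
      constructor <;> linarith [h1 x, h1 y, h2 x, h2 y]
  have hg : ∀ x, g x = max 0 (min 1 (-F x)) := fun _ => rfl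
  have hz : ∫ x, g x ∂ν = 0 := by
    refine tendsto_nhds_unique (hlim g) ?_
    refine tendsto_const_nhds.congr' ?_
    filter_upwards [h0] with i hi
    refine (integral_eq_zero_of_ae ?_).symm
    filter_upwards [hi] with x hx
    rw [hg, max_eq_left ((min_le_right _ _).trans (neg_nonpos.2 hx))]
    rfl
  rw [integral_eq_zero_iff_of_nonneg (f := g) (fun x => le_max_left _ _) (g.integrable ν)] at hz
  refine measure_mono_null (fun x hx => ?_) (ae_iff.1 hz)
  have hx' : F x < 0 := hx
  change ¬ (g x = 0)
  rw [hg]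
  exact (lt_of_lt_of_le (lt_min one_pos (neg_pos.2 hx')) (le_max_right _ _)).ne'

theorem abs_clamp_le {k x : ℝ} (hk : 0 ≤ k) : |max (-k) (min x k)| ≤ k :=
  abs_le.2 ⟨le_max_left _ _, max_le (by linarith) (min_le_right _ _)⟩

theorem abs_clamp_le_abs {k x : ℝ} (hk : 0 ≤ k) : |max (-k) (min x k)| ≤ |x| := by
  rcases max_cases (-k) (min x k) with h | h <;> rcases min_cases x k with h' | h' <;>
    rcases abs_cases x with hx | hx <;> rw [abs_le] <;> constructor <;> linarith

theorem abs_clamp_sub_le {k x : ℝ} (hk : 0 < k) : |max (-k) (min x k) - x| ≤ x ^ 2 / k := by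
  rw [le_div_iff₀ hk]
  rcases max_cases (-k) (min x k) with h | h <;> rcases min_cases x k with h' | h' <;>
    rcases abs_cases (max (-k) (min x k) - x) with hx | hx <;> rw [hx.1] <;> nlinarith

theorem tendsto_clamp (x : ℝ) :
    Tendsto (fun k : ℕ => max (-((k : ℝ) + 1)) (min x ((k : ℝ) + 1))) atTop (𝓝 x) := by
  refine tendsto_const_nhds.congr' ?_
  filter_upwards [eventually_ge_atTop ⌈|x|⌉₊] with k hk
  have : |x| ≤ k := Nat.ceil_le.1 hk
  have := abs_le.1 this
  rw [min_eq_left (by linarith), max_eq_right (by linarith)]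

theorem integral_eq_of_tendsto [IsFiniteMeasure ν] [∀ i, IsProbabilityMeasure (μ i)]
    (hlim : ∀ g : BoundedContinuousFunction E ℝ,
      Tendsto (fun i => ∫ x, g x ∂(μ i)) l (𝓝 (∫ x, g x ∂ν)))
    {F : E → ℝ} (hF : Continuous F) {a b : ℝ}
    (h1 : ∀ᶠ i in l, Integrable F (μ i) ∧ ∫ x, F x ∂(μ i) = a)
    (h2 : ∀ᶠ i in l, Integrable (fun x => F x ^ 2) (μ i) ∧ ∫ x, F x ^ 2 ∂(μ i) = b) :
    Integrable F ν ∧ ∫ x, F x ∂ν = a := by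
  have hpos : ∀ k : ℕ, (0 : ℝ) < (k : ℝ) + 1 := fun k => by positivity
  let g : ℕ → BoundedContinuousFunction E ℝ := fun k =>
    BoundedContinuousFunction.ofNormedAddCommGroup
    (fun x => max (-((k : ℝ) + 1)) (min (F x) ((k : ℝ) + 1))) (by fun_prop) ((k : ℝ) + 1)
    fun x => abs_clamp_le (hpos k).le
  have hg : ∀ k x, g k x = max (-((k : ℝ) + 1)) (min (F x) ((k : ℝ) + 1)) := fun _ _ => rfl
  have hgle : ∀ k x, |g k x| ≤ |F x| := fun k x => abs_clamp_le_abs (hpos k).le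
  have hpt : ∀ x, Tendsto (fun k => g k x) atTop (𝓝 (F x)) := fun x => tendsto_clamp (F x)
  have habs : ∀ k, ∫ x, |g k x| ∂ν ≤ 1 + b := fun k => by
    refine le_of_tendsto (hlim |g k|) ?_
    filter_upwards [h2] with i hi
    have : ∫ x, (1 + F x ^ 2) ∂(μ i) = 1 + b := by
      rw [integral_add (integrable_const _) hi.1, hi.2]; simp
    rw [← this]
    refine integral_mono (BoundedContinuousFunction.integrable _ _)
      ((integrable_const _).add hi.1) fun x => ?_
    change |g k x| ≤ _
    refine (hgle k x).trans ?_
    nlinarith [sq_abs (F x), sq_nonneg (|F x| - 1), abs_nonneg (F x)]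
  have hint : Integrable F ν := by
    refine ⟨hF.aestronglyMeasurable, ?_⟩
    have hle : ∫⁻ x, ‖F x‖ₑ ∂ν ≤ liminf (fun k => ∫⁻ x, ‖g k x‖ₑ ∂ν) atTop := by
      rw [lintegral_congr fun x => ((hpt x).enorm.liminf_eq).symm]
      exact lintegral_liminf_le fun k => (g k).continuous.measurable.enorm
    refine lt_of_le_of_lt hle (lt_of_le_of_lt (b := ENNReal.ofReal (1 + b)) ?_
      ENNReal.ofReal_lt_top)
    refine liminf_le_of_le (by isBoundedDefault) fun c hc => ?_
    obtain ⟨k, hk⟩ := hc.exists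
    refine hk.trans ?_
    rw [← ofReal_integral_norm_eq_lintegral_enorm ((g k).integrable ν)]
    exact ENNReal.ofReal_le_ofReal (habs k)
  refine ⟨hint, ?_⟩
  have hA : Tendsto (fun k => ∫ x, g k x ∂ν) atTop (𝓝 (∫ x, F x ∂ν)) :=
    tendsto_integral_of_dominated_convergence (fun x => |F x|)
      (fun k => (g k).continuous.aestronglyMeasurable) hint.abs
      (fun k => Eventually.of_forall fun x => hgle k x) (Eventually.of_forall hpt)
  have hB : ∀ k, |∫ x, g k x ∂ν - a| ≤ b / ((k : ℝ) + 1) := fun k => by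
    refine le_of_tendsto ((hlim (g k)).sub_const a).abs ?_
    filter_upwards [h1, h2] with i hi hi2
    rw [← hi.2, ← integral_sub ((g k).integrable _) hi.1, ← hi2.2, ← integral_div]
    refine abs_integral_le_integral_abs.trans ?_
    exact integral_mono (((g k).integrable _).sub hi.1).abs (hi2.1.div_const _)
      fun x => abs_clamp_sub_le (hpos k)
  have hC : Tendsto (fun k => ∫ x, g k x ∂ν) atTop (𝓝 a) := by
    rw [tendsto_iff_norm_sub_tendsto_zero]
    refine squeeze_zero (fun _ => norm_nonneg _) hB ?_
    exact tendsto_const_nhds.div_atTop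
      (tendsto_atTop_add_const_right _ _ tendsto_natCast_atTop_atTop)
  exact tendsto_nhds_unique hA hC

end Limit

/-! ### Characters of polynomial algebras -/

/-- The character of a polynomial algebra given by evaluation at a point. -/
noncomputable def evalChar {σ : Type*} (c : σ → ℝ) : CharSpace (MvPolynomial σ ℝ) :=
  (MvPolynomial.aeval c : MvPolynomial σ ℝ →ₐ[ℝ] ℝ)

theorem evalChar_apply {σ : Type*} (c : σ → ℝ) (P : MvPolynomial σ ℝ) :
    evalChar c P = MvPolynomial.eval c P :=
  MvPolynomial.aeval_eq_eval c ▸ rfl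

theorem continuous_evalChar {σ : Type*} :
    Continuous (evalChar : (σ → ℝ) → CharSpace (MvPolynomial σ ℝ)) :=
  CharSpace.continuous_iff.2 fun P => by
    simp only [evalChar_apply]
    exact MvPolynomial.continuous_eval P

theorem evalChar_coe {σ : Type*} (β : CharSpace (MvPolynomial σ ℝ)) :
    evalChar (fun v => β (MvPolynomial.X v)) = β :=
  MvPolynomial.algHom_ext (f := (evalChar fun v => β (MvPolynomial.X v)))
    (g := (show MvPolynomial σ ℝ →ₐ[ℝ] ℝ from β)) fun v =>
      (evalChar_apply _ _).trans (MvPolynomial.eval_X v)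

/-- The characters of a polynomial algebra whose values at the variables are bounded by `r`. -/
def boundedChars {σ : Type*} (r : σ → ℝ) : Set (CharSpace (MvPolynomial σ ℝ)) :=
  {β | ∀ v, |β (MvPolynomial.X v)| ≤ r v}

theorem isCompact_boundedChars {σ : Type*} (r : σ → ℝ) : IsCompact (boundedChars r) := by
  have h : IsCompact (Set.pi Set.univ fun v => Set.Icc (-r v) (r v)) :=
    isCompact_univ_pi fun v => isCompact_Icc
  convert h.image continuous_evalChar using 1
  ext β
  constructor
  · exact fun hβ => ⟨fun v => β (MvPolynomial.X v), fun v _ => abs_le.1 (hβ v), evalChar_coe β⟩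
  · rintro ⟨c, hc, rfl⟩ v
    rw [evalChar_apply, MvPolynomial.eval_X]
    exact abs_le.2 (hc v trivial)

/-! ### Representing measures -/

section Representing

variable {A : Type*} [CommRing A] [Algebra ℝ A]

theorem CharSpace.measurable_eval (a : A) : Measurable fun α : CharSpace A => α a :=
  (CharSpace.continuous_eval a).measurable

theorem IsRepresenting.isProbabilityMeasure {L : A →ₗ[ℝ] ℝ} {ν : Measure (CharSpace A)}
    (h : IsRepresenting L ν) (h1 : L 1 = 1) : IsProbabilityMeasure ν := by
  have hint := h.integrable 1
  have heq := h.eq_integral 1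
  simp only [map_one] at hint heq
  have : IsFiniteMeasure ν := (integrable_const_iff_isFiniteMeasure one_ne_zero).1 hint
  refine ⟨?_⟩
  rw [h1] at heq
  simp only [integral_const, smul_eq_mul, mul_one] at heq
  rw [← ENNReal.toReal_eq_one_iff]
  exact heq.symm

end Representing

/-! ### The subalgebras generated by finite subsets -/

section FinGen

variable {A : Type*} [CommRing A] [Algebra ℝ A] {V : Submodule ℝ A}

/-- The subalgebra generated by a finite subset of `V`. -/
def spanAlg (t : Finset V) : finGenSubalgebras V :=
  ⟨Algebra.adjoin ℝ (((Submodule.span ℝ (t : Set V)).map V.subtype : Submodule ℝ A) : Set A),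
    _, Submodule.map_subtype_le _ _, inferInstance, rfl⟩

theorem mem_spanAlg {t : Finset V} {v : V} (hv : v ∈ Submodule.span ℝ (t : Set V)) :
    (v : A) ∈ (spanAlg t : Subalgebra ℝ A) :=
  Algebra.subset_adjoin ⟨v, hv, rfl⟩

open scoped Classical in
/-- Extension by zero of a character of `spanAlg t` to the free algebra on `V`. -/
noncomputable def extendChar (t : Finset V) (α : CharSpace (spanAlg t : Subalgebra ℝ A)) :
    CharSpace (MvPolynomial V ℝ) :=
  evalChar fun v =>
    if h : v ∈ Submodule.span ℝ (t : Set V) then α ⟨(v : A), mem_spanAlg h⟩ else 0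

theorem continuous_extendChar (t : Finset V) : Continuous (extendChar t) := by
  refine continuous_evalChar.comp (continuous_pi fun v => ?_)
  split_ifs with h
  · exact CharSpace.continuous_eval _
  · exact continuous_const

theorem extendChar_X {t : Finset V} (α : CharSpace (spanAlg t : Subalgebra ℝ A)) {v : V}
    (h : v ∈ Submodule.span ℝ (t : Set V)) :
    extendChar t α (MvPolynomial.X v) = α ⟨(v : A), mem_spanAlg h⟩ := by
  rw [extendChar, evalChar_apply, MvPolynomial.eval_X, dif_pos h]

theorem extendChar_X_of_notMem {t : Finset V} (α : CharSpace (spanAlg t : Subalgebra ℝ A)) {v : V}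
    (h : v ∉ Submodule.span ℝ (t : Set V)) : extendChar t α (MvPolynomial.X v) = 0 := by
  rw [extendChar, evalChar_apply, MvPolynomial.eval_X, dif_neg h]

/-- The canonical homomorphism from the free algebra on `V` to `A`. -/
noncomputable def freeProj (V : Submodule ℝ A) : MvPolynomial V ℝ →ₐ[ℝ] A :=
  MvPolynomial.aeval fun v : V => (v : A)

theorem freeProj_X (v : V) : freeProj V (MvPolynomial.X v) = v := MvPolynomial.aeval_X _ v

theorem freeProj_surjective (hV : Algebra.adjoin ℝ (V : Set A) = ⊤) :
    Function.Surjective (freeProj V) := by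
  rw [← AlgHom.range_eq_top, freeProj, ← Algebra.adjoin_range_eq_range_aeval,
    Subtype.range_coe_subtype]
  exact hV

theorem eventually_extendChar_apply (P : MvPolynomial V ℝ) :
    ∀ᶠ t : Finset V in atTop, ∃ h : freeProj V P ∈ (spanAlg t : Subalgebra ℝ A),
      ∀ α, extendChar t α P = α ⟨freeProj V P, h⟩ := by
  induction P using MvPolynomial.induction_on with
  | C r =>
    have hr : freeProj V (MvPolynomial.C r) = algebraMap ℝ A r := by
      rw [← MvPolynomial.algebraMap_eq, AlgHom.commutes]
    refine Eventually.of_forall fun t => ⟨?_, fun α => ?_⟩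
    · rw [hr]
      exact Subalgebra.algebraMap_mem _ r
    · have h1 : extendChar t α (MvPolynomial.C r) = r := by
        rw [extendChar, evalChar_apply, MvPolynomial.eval_C]
      rw [h1]
      have h2 : α (algebraMap ℝ _ r) = r := AlgHomClass.commutes α r
      exact h2.symm.trans (congrArg α (Subtype.ext hr.symm))
  | add P Q hP hQ =>
    filter_upwards [hP, hQ] with t ⟨h1, h1'⟩ ⟨h2, h2'⟩
    have h : freeProj V (P + Q) ∈ (spanAlg t : Subalgebra ℝ A) := by
      rw [map_add]; exact add_mem h1 h2
    refine ⟨h, fun α => ?_⟩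
    rw [map_add, h1', h2', ← map_add]
    exact congrArg α (Subtype.ext (map_add _ _ _).symm)
  | mul_X P v hP =>
    filter_upwards [hP, eventually_ge_atTop {v}] with t ⟨h1, h1'⟩ ht
    have hv : v ∈ Submodule.span ℝ (t : Set V) :=
      Submodule.subset_span (ht (Finset.mem_singleton_self v))
    have hmul : freeProj V (P * MvPolynomial.X v) = freeProj V P * v := by
      rw [map_mul, freeProj_X]
    have h : freeProj V (P * MvPolynomial.X v) ∈ (spanAlg t : Subalgebra ℝ A) := by
      rw [hmul]; exact mul_mem h1 (mem_spanAlg hv)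
    refine ⟨h, fun α => ?_⟩
    rw [map_mul, h1', extendChar_X α hv, ← map_mul]
    exact congrArg α (Subtype.ext hmul.symm)

/-- The restriction of a character of `spanAlg t` to the span of `t`. -/
def spanEval (t : Finset V) (α : CharSpace (spanAlg t : Subalgebra ℝ A)) :
    Submodule.span ℝ (t : Set V) →ₗ[ℝ] ℝ where
  toFun w := α ⟨((w : V) : A), mem_spanAlg w.2⟩
  map_add' v w := by rw [← map_add]; rfl
  map_smul' r v := by
    rw [RingHom.id_apply, ← map_smul]; rfl

end FinGen

section Construction

variable {A : Type*} [CommRing A] [Algebra ℝ A] {V : Submodule ℝ A}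

theorem sum_sq_le_of_seminormTrace {V : Type*} [AddCommGroup V] [Module ℝ V] {p q : Seminorm ℝ V}
    (h : seminormTrace p q < ∞) :
    (∀ v, q v = 0 → p v = 0) ∧
      ∀ E : Finset V, IsFON q E → ∑ e ∈ E, p e ^ 2 ≤ (seminormTrace p q).toReal := by
  by_cases hk : ∀ v, q v = 0 → p v = 0
  · refine ⟨hk, fun E hE => ?_⟩
    rw [← ENNReal.ofReal_le_iff_le_toReal h.ne,
      ENNReal.ofReal_sum_of_nonneg fun _ _ => sq_nonneg _, seminormTrace, if_pos hk]
    exact le_iSup₂ (f := fun (E : Finset V) (_ : IsFON q E) =>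
      ∑ e ∈ E, ENNReal.ofReal (p e ^ 2)) E hE
  · rw [seminormTrace, if_neg hk] at h
    exact absurd h (lt_irrefl _)

theorem IsConcentrated.ae_eq_zero {p : Seminorm ℝ V}
    {ν : ∀ S : finGenSubalgebras V, Measure (CharSpace (S : Subalgebra ℝ A))}
    (h : IsConcentrated p ν) {S : finGenSubalgebras V} {a : V} (ha : p a = 0)
    (haS : (a : A) ∈ (S : Subalgebra ℝ A)) : ∀ᵐ α ∂(ν S), α ⟨(a : A), haS⟩ = 0 := by
  have key : ∀ k : ℕ, ν S {α | 1 ≤ |(k : ℝ) * α ⟨(a : A), haS⟩|} = 0 := fun k => by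
    refine nonpos_iff_eq_zero.1 (ENNReal.le_of_forall_pos_le_add fun ε hε _ => ?_)
    obtain ⟨δ, hδ, hc⟩ := h ε (by exact_mod_cast hε)
    have hpk : p ((k : ℝ) • a) ≤ δ := by rw [map_smul_eq_mul, ha, mul_zero]; exact hδ.le
    have := hc S ((k : ℝ) • a) hpk (Submodule.smul_mem _ _ haS : _ ∈ Subalgebra.toSubmodule S.1)
    rw [ENNReal.ofReal_coe_nnreal] at this
    rw [zero_add]
    convert this using 5 with α
    exact congrArg abs (map_smul α (k : ℝ) ⟨(a : A), haS⟩).symm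
  have hall : ∀ᵐ α ∂(ν S), ∀ k : ℕ, ¬ 1 ≤ |(k : ℝ) * α ⟨(a : A), haS⟩| :=
    ae_all_iff.2 fun k => by simpa [ae_iff] using key k
  filter_upwards [hall] with α hα
  by_contra hne
  obtain ⟨k, hk⟩ := exists_nat_ge (1 / |α ⟨(a : A), haS⟩|)
  refine hα k ?_
  rw [abs_mul, Nat.abs_cast]
  rwa [div_le_iff₀ (abs_pos.2 hne)] at hk

theorem measure_extendChar_le {p q : Seminorm ℝ V} (hp : IsHilbertian p) (hq : IsHilbertian q)
    (hpq : seminormTrace p q < ∞)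
    {ν : ∀ S : finGenSubalgebras V, Measure (CharSpace (S : Subalgebra ℝ A))}
    [∀ S, IsProbabilityMeasure (ν S)] (hν : IsConcentrated p ν)
    {ε δ n : ℝ} (hε : 0 ≤ ε) (hδ : 0 < δ) (hn : 0 < n)
    (hconc : ∀ S : finGenSubalgebras V, ∀ a : V, p a ≤ δ →
      ∀ ha : (a : A) ∈ (S : Subalgebra ℝ A),
        ν S {α : CharSpace (S : Subalgebra ℝ A) | 1 ≤ |α ⟨(a : A), ha⟩|} ≤ ENNReal.ofReal ε)
    (t : Finset V) :
    (ν (spanAlg t)).map (extendChar t) (boundedChars fun v => n * q v)ᶜ ≤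
      ENNReal.ofReal (20 / 3 * (ε + 4 * (seminormTrace p q).toReal / (δ ^ 2 * n ^ 2))) := by
  obtain ⟨Bp, hps, hp0, hpB⟩ := hp
  obtain ⟨Bq, hqs, hq0, hqB⟩ := hq
  obtain ⟨hker, htr⟩ := sum_sq_le_of_seminormTrace hpq
  set W := Submodule.span ℝ (t : Set V)
  have : FiniteDimensional ℝ W := FiniteDimensional.span_finset ℝ t
  let Cq : W →ₗ[ℝ] W →ₗ[ℝ] ℝ := Bq.compl₁₂ W.subtype W.subtype
  let Cp : W →ₗ[ℝ] W →ₗ[ℝ] ℝ := Bp.compl₁₂ W.subtype W.subtype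
  have hp2 : ∀ v, p v ^ 2 = Bp v v := fun v => by rw [hpB, Real.sq_sqrt (hp0 v)]
  have hbound := measure_exists_lt_le (W := W) (ν (spanAlg t)) (Bq := Cq) (Bp := Cp)
    (T := (seminormTrace p q).toReal) (X := spanEval t)
    (fun v w => hqs v w) (fun v => hq0 v) (fun v => hp0 v) (fun E hE => ?_)
    (fun w => CharSpace.measurable_eval _) (fun z hz => ?_) hε hδ hn (fun w hw => ?_)
  · rw [Measure.map_apply (continuous_extendChar t).measurable
      (isCompact_boundedChars _).isClosed.measurableSet.compl]
    refine (measure_mono fun α hα => ?_).trans hbound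
    have hα' : ¬ ∀ v, |extendChar t α (MvPolynomial.X v)| ≤ n * q v := hα
    push Not at hα'
    obtain ⟨v, hv⟩ := hα'
    by_cases hvW : v ∈ W
    · refine ⟨⟨v, hvW⟩, ?_⟩
      rw [extendChar_X α hvW, hqB] at hv
      exact hv
    · rw [extendChar_X_of_notMem α hvW, abs_zero] at hv
      exact absurd hv (not_lt.2 (mul_nonneg hn.le (apply_nonneg q v)))
  · have := htr (E.map (Function.Embedding.subtype _)) ⟨fun e he => ?_, fun e he f hf hef => ?_⟩
    · simpa [Finset.sum_map, hp2, Cp] using this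
    · obtain ⟨w, hw, rfl⟩ := Finset.mem_map.1 he
      rw [hqB]
      exact (congrArg Real.sqrt (hE.1 w hw)).trans Real.sqrt_one
    · obtain ⟨w, hw, rfl⟩ := Finset.mem_map.1 he
      obtain ⟨w', hw', rfl⟩ := Finset.mem_map.1 hf
      rw [polarForm_eq q Bq hqs hq0 hqB]
      exact hE.2 w hw w' hw' fun h => hef (congrArg _ h)
  · refine hν.ae_eq_zero (hker _ ?_) (mem_spanAlg z.2)
    rw [hqB]
    exact (congrArg Real.sqrt hz).trans Real.sqrt_zero
  · refine hconc (spanAlg t) w ?_ (mem_spanAlg w.2)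
    refine (sq_le_sq₀ (apply_nonneg p _) hδ.le).1 ?_
    rw [hp2]
    exact hw

theorem exists_measure_extendChar_le {p q : Seminorm ℝ V} (hp : IsHilbertian p)
    (hq : IsHilbertian q) (hpq : seminormTrace p q < ∞)
    {ν : ∀ S : finGenSubalgebras V, Measure (CharSpace (S : Subalgebra ℝ A))}
    [∀ S, IsProbabilityMeasure (ν S)] (hν : IsConcentrated p ν) {η : ℝ≥0∞} (hη : 0 < η) :
    ∃ n : ℕ, ∀ t : Finset V,
      (ν (spanAlg t)).map (extendChar t) (boundedChars fun v => (n : ℝ) * q v)ᶜ ≤ η := by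
  obtain ⟨e, he, heη⟩ : ∃ e : ℝ, 0 < e ∧ ENNReal.ofReal e ≤ η := by
    obtain ⟨e, he, h⟩ := ENNReal.lt_iff_exists_nnreal_btwn.1 hη
    exact ⟨e, by exact_mod_cast he, by rw [ENNReal.ofReal_coe_nnreal]; exact h.le⟩
  obtain ⟨δ, hδ, hc⟩ := hν (3 * e / 40) (by positivity)
  set T := (seminormTrace p q).toReal
  obtain ⟨n, hn⟩ := exists_nat_ge (1 + 4 * T / (δ ^ 2 * (3 * e / 40)))
  have hT : 0 ≤ T := ENNReal.toReal_nonneg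
  have hn1 : (1 : ℝ) ≤ n := le_trans (le_add_of_nonneg_right (by positivity)) hn
  refine ⟨n, fun t => (measure_extendChar_le hp hq hpq hν (by positivity) hδ
    (by linarith : (0 : ℝ) < n) hc t).trans (le_trans (ENNReal.ofReal_le_ofReal ?_) heη)⟩
  have h1 : 4 * T / (δ ^ 2 * n ^ 2) ≤ 3 * e / 40 := by
    have h2 : 4 * T / (δ ^ 2 * (3 * e / 40)) ≤ (n : ℝ) ^ 2 := by nlinarith
    rw [div_le_iff₀ (by positivity)] at h2 ⊢
    linarith
  linarith

theorem integrable_extendChar {L : A →ₗ[ℝ] ℝ}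
    {ν : ∀ S : finGenSubalgebras V, Measure (CharSpace (S : Subalgebra ℝ A))}
    (hν : ∀ S : finGenSubalgebras V,
      IsRepresenting (L ∘ₗ (S : Subalgebra ℝ A).val.toLinearMap) (ν S)) (P : MvPolynomial V ℝ) :
    ∀ᶠ t : Finset V in atTop,
      Integrable (fun β : CharSpace (MvPolynomial V ℝ) => β P)
        ((ν (spanAlg t)).map (extendChar t)) ∧
      ∫ β : CharSpace (MvPolynomial V ℝ), β P ∂((ν (spanAlg t)).map (extendChar t)) =
        L (freeProj V P) := by
  filter_upwards [eventually_extendChar_apply P] with t ⟨h, ht⟩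
  have hm := (continuous_extendChar t).measurable.aemeasurable (μ := ν (spanAlg t))
  have hP := (CharSpace.continuous_eval P).aestronglyMeasurable
    (μ := (ν (spanAlg t)).map (extendChar t))
  rw [integrable_map_measure hP hm, integral_map hm hP, Function.comp_def]
  simp only [ht]
  exact ⟨(hν _).integrable _, ((hν _).eq_integral ⟨freeProj V P, h⟩).symm⟩

theorem ae_nonneg_extendChar {Q : Set A}
    {ν : ∀ S : finGenSubalgebras V, Measure (CharSpace (S : Subalgebra ℝ A))}
    (hν : ∀ S : finGenSubalgebras V, IsSupportedIn (ν S)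
      (nonnegSet {a : (S : Subalgebra ℝ A) | (a : A) ∈ Q})) {P : MvPolynomial V ℝ}
    (hP : freeProj V P ∈ Q) :
    ∀ᶠ t : Finset V in atTop, ∀ᵐ β ∂((ν (spanAlg t)).map (extendChar t)),
      (0 : ℝ) ≤ (β : CharSpace (MvPolynomial V ℝ)) P := by
  filter_upwards [eventually_extendChar_apply P] with t ⟨h, ht⟩
  rw [ae_map_iff (continuous_extendChar t).measurable.aemeasurable
    (isClosed_le continuous_const (CharSpace.continuous_eval P)).measurableSet]
  filter_upwards [mem_ae_iff.2 (hν (spanAlg t))] with α hα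
  rw [ht]
  exact hα _ hP

theorem exists_representing_of_concentrated (hV : Algebra.adjoin ℝ (V : Set A) = ⊤)
    {q : Seminorm ℝ V} (hq : IsHilbertian q) {L : A →ₗ[ℝ] ℝ} (hL : L 1 = 1) {Q : Set A}
    (hQ : IsQuadraticModule Q) {p : Seminorm ℝ V} (hp : IsHilbertian p)
    (hpq : seminormTrace p q < ∞)
    {ν : ∀ S : finGenSubalgebras V, Measure (CharSpace (S : Subalgebra ℝ A))}
    (hrep : ∀ S : finGenSubalgebras V,
      IsRepresenting (L ∘ₗ (S : Subalgebra ℝ A).val.toLinearMap) (ν S))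
    (hsupp : ∀ S : finGenSubalgebras V, IsSupportedIn (ν S)
      (nonnegSet {a : (S : Subalgebra ℝ A) | (a : A) ∈ Q}))
    (hν : IsConcentrated p ν) :
    ∃ μ : Measure (CharSpace A), IsRepresenting L μ ∧
      IsSupportedIn μ {α ∈ nonnegSet Q | IsContinuousOn q α} := by
  have hprob : ∀ S, IsProbabilityMeasure (ν S) := fun S =>
    (hrep S).isProbabilityMeasure (by simpa using hL)
  have hprob' : ∀ t : Finset V, IsProbabilityMeasure ((ν (spanAlg t)).map (extendChar t)) :=
    fun t => Measure.isProbabilityMeasure_map (continuous_extendChar t).measurable.aemeasurable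
  obtain ⟨m, hm1, hm2, hm3, hlim⟩ := exists_innerRegular_tendsto
    (Ultrafilter.of (atTop : Filter (Finset V)))
    (fun t => (ν (spanAlg t)).map (extendChar t))
    (C := fun n : ℕ => boundedChars fun v => (n : ℝ) * q v) (fun n => isCompact_boundedChars _)
    (fun i j hij β hβ v => (hβ v).trans
      (mul_le_mul_of_nonneg_right (Nat.cast_le.2 hij) (apply_nonneg q v)))
    (fun η hη => exists_measure_extendChar_le hp hq hpq hν hη)
  have hof := Ultrafilter.of_le (atTop : Filter (Finset V))
  have hneg : m (⋃ P : {P : MvPolynomial V ℝ // freeProj V P ∈ Q},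
      {β : CharSpace (MvPolynomial V ℝ) | β P.1 < 0}) = 0 :=
    measure_iUnion_eq_zero_of_innerRegular m
      (fun P => isOpen_lt (CharSpace.continuous_eval _) continuous_const)
      fun P => measure_lt_zero_of_tendsto hlim (CharSpace.continuous_eval P.1)
        ((ae_nonneg_extendChar hsupp P.2).filter_mono hof)
  have hnonneg : ∀ᵐ β ∂m, ∀ P : MvPolynomial V ℝ, freeProj V P ∈ Q → 0 ≤ β P := by
    filter_upwards [compl_mem_ae_iff.2 hneg] with β hβ P hP
    by_contra hcon
    exact hβ (Set.mem_iUnion.2 ⟨⟨P, hP⟩, not_le.1 hcon⟩)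
  have h0Q : (0 : A) ∈ Q := by simpa using hQ.sq_mul_mem 0 1 hQ.one_mem
  have hemb := CharSpace.isClosedEmbedding_comp (freeProj_surjective hV)
  have hrange : ∀ᵐ β ∂m, β ∈ Set.range (CharSpace.comp (freeProj V)) := by
    filter_upwards [hnonneg] with β hβ
    refine CharSpace.mem_range_comp (freeProj_surjective hV) fun P hP => ?_
    have h1 := hβ P (by rwa [hP])
    have h2 := hβ (-P) (by rwa [map_neg, hP, neg_zero])
    rw [map_neg] at h2
    linarith
  set φ : CharSpace A → CharSpace (MvPolynomial V ℝ) := CharSpace.comp (freeProj V)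
  have hme : MeasurableEmbedding φ := hemb.measurableEmbedding
  have hmap : (m.comap φ).map φ = m := by
    rw [hme.map_comap, Measure.restrict_eq_self_of_ae_mem hrange]
  have hfin : IsFiniteMeasure (m.comap φ) := by
    refine ⟨?_⟩
    rw [hme.comap_apply]
    exact measure_lt_top _ _
  have hmom : ∀ P : MvPolynomial V ℝ,
      Integrable (fun β : CharSpace (MvPolynomial V ℝ) => β P) m ∧
        ∫ β : CharSpace (MvPolynomial V ℝ), β P ∂m = L (freeProj V P) := fun P =>
    integral_eq_of_tendsto hlim (CharSpace.continuous_eval P)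
      ((integrable_extendChar hrep P).filter_mono hof)
      (b := L (freeProj V (P ^ 2)))
      (by
        have hsq : (fun β : CharSpace (MvPolynomial V ℝ) => β (P ^ 2)) = fun β => β P ^ 2 :=
          funext fun β => map_pow β P 2
        refine ((integrable_extendChar hrep (P ^ 2)).filter_mono hof).mono fun t ht => ?_
        rwa [hsq] at ht)
  have hmom' : ∀ a : A, Integrable (fun α : CharSpace A => α a) (m.comap φ) ∧
      ∫ α : CharSpace A, α a ∂(m.comap φ) = L a := fun a => by
    obtain ⟨P, rfl⟩ := freeProj_surjective hV a
    have h := hmom P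
    rw [← hmap, hme.integrable_map_iff, hme.integral_map] at h
    exact h
  refine ⟨m.comap φ, ⟨inferInstance, innerRegular_comap_of_isClosedEmbedding hemb m,
    fun a => (hmom' a).1, fun a => (hmom' a).2.symm⟩, ?_⟩
  rw [IsSupportedIn, hme.comap_apply]
  have hall : ∀ᵐ β ∂m, (∀ P : MvPolynomial V ℝ, freeProj V P ∈ Q → 0 ≤ β P) ∧
      β ∈ ⋃ n : ℕ, boundedChars fun v => (n : ℝ) * q v :=
    hnonneg.and (mem_ae_iff.2 hm3)
  refine measure_mono_null ?_ (ae_iff.1 hall)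
  rintro _ ⟨α, hα, rfl⟩ ⟨h1, h2⟩
  refine hα ⟨fun a ha => ?_, ?_⟩
  · obtain ⟨P, rfl⟩ := freeProj_surjective hV a
    exact h1 P ha
  · obtain ⟨n, hn⟩ := Set.mem_iUnion.1 h2
    refine ⟨n + 1, by positivity, fun v => ?_⟩
    have hv := hn v
    rw [CharSpace.comp_apply, freeProj_X] at hv
    refine hv.trans (mul_le_mul_of_nonneg_right (by linarith) (apply_nonneg q v))

end Construction

/-! ### Seminorms of semidefinite forms -/

/-- The Hilbertian seminorm `v ↦ √(B v v)` of a symmetric positive semidefinite form. -/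
noncomputable def formSeminorm {V : Type*} [AddCommGroup V] [Module ℝ V] (B : V →ₗ[ℝ] V →ₗ[ℝ] ℝ)
    (hs : ∀ v w, B v w = B w v) (h0 : ∀ v, 0 ≤ B v v) : Seminorm ℝ V :=
  Seminorm.of (fun v => Real.sqrt (B v v))
    (fun v w => by
      have hcs : B v w ≤ Real.sqrt (B v v) * Real.sqrt (B w w) := by
        rw [← Real.sqrt_mul (h0 v)]
        refine Real.le_sqrt_of_sq_le ?_
        have := LinearMap.BilinForm.apply_mul_apply_le_of_forall_zero_le B h0 v w
        rwa [hs w v, ← sq] at this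
      rw [Real.sqrt_le_left (by positivity)]
      simp only [map_add, LinearMap.add_apply, hs w v]
      nlinarith [Real.sq_sqrt (h0 v), Real.sq_sqrt (h0 w)])
    fun r v => by
      simp only [map_smul, LinearMap.smul_apply, smul_eq_mul]
      rw [← mul_assoc, Real.sqrt_mul (mul_self_nonneg r), Real.sqrt_mul_self_eq_abs,
        Real.norm_eq_abs]

section Restriction

variable {A : Type*} [CommRing A] [Algebra ℝ A] {V : Submodule ℝ A}

theorem IsRepresenting.map_comp {B : Type*} [CommRing B] [Algebra ℝ B] {L : A →ₗ[ℝ] ℝ}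
    {ν : Measure (CharSpace A)} [IsFiniteMeasure ν] (h : IsRepresenting L ν) (φ : B →ₐ[ℝ] A) :
    IsRepresenting (L ∘ₗ φ.toLinearMap) (ν.map (CharSpace.comp φ)) := by
  have hm := (CharSpace.continuous_comp φ).measurable.aemeasurable (μ := ν)
  have hb : ∀ b : B, AEStronglyMeasurable (fun β : CharSpace B => β b)
      (ν.map (CharSpace.comp φ)) := fun b => (CharSpace.continuous_eval b).aestronglyMeasurable
  have := h.innerRegular
  refine ⟨inferInstance, Measure.InnerRegular.map_of_continuous (CharSpace.continuous_comp φ),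
    fun b => ?_, fun b => ?_⟩
  · rw [integrable_map_measure (hb b) hm]
    exact h.integrable (φ b)
  · rw [integral_map hm (hb b)]
    exact h.eq_integral (φ b)

theorem IsSupportedIn.map_comp {Q : Set A} {ν : Measure (CharSpace A)}
    (h : IsSupportedIn ν (nonnegSet Q)) (S : Subalgebra ℝ A) :
    IsSupportedIn (ν.map (CharSpace.comp S.val)) (nonnegSet {a : S | (a : A) ∈ Q}) := by
  rw [IsSupportedIn, Measure.map_apply (CharSpace.continuous_comp _).measurable
    (isClosed_nonnegSet _).measurableSet.compl]
  refine measure_mono_null (fun α hα => ?_) h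
  exact fun hα' : α ∈ nonnegSet Q => hα fun a ha => hα' a ha

/-! ### The dual norm of a character -/

/-- The dual norm, with respect to `q`, of the restriction of a character to `V`. -/
noncomputable def dualNorm (q : Seminorm ℝ V) (α : CharSpace A) : ℝ≥0∞ :=
  ⨆ v : {v : V // q v ≤ 1}, ENNReal.ofReal |α ((v : V) : A)|

theorem measurable_dualNorm (q : Seminorm ℝ V) :
    Measurable (dualNorm q : CharSpace A → ℝ≥0∞) := by
  have : LowerSemicontinuous (dualNorm q : CharSpace A → ℝ≥0∞) :=
    lowerSemicontinuous_iSup fun v =>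
      (ENNReal.continuous_ofReal.comp (CharSpace.continuous_eval _).abs).lowerSemicontinuous
  exact this.measurable

theorem IsContinuousOn.abs_le {q : Seminorm ℝ V} {α : CharSpace A} (h : IsContinuousOn q α)
    (v : V) : |α (v : A)| ≤ (dualNorm q α).toReal * q v := by
  obtain ⟨C, hC, hα⟩ := h
  rcases (apply_nonneg q v).eq_or_lt with hv | hv
  · have := hα v
    rwa [← hv, mul_zero] at this ⊢
  have hfin : dualNorm q α ≠ ∞ := by
    refine ne_top_of_le_ne_top (b := ENNReal.ofReal C) ENNReal.ofReal_ne_top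
      (iSup_le fun w => ENNReal.ofReal_le_ofReal ?_)
    exact (hα w).trans (mul_le_of_le_one_right hC.le w.2)
  have hq : q ((q v)⁻¹ • v) ≤ 1 := by
    rw [map_smul_eq_mul, Real.norm_of_nonneg (by positivity), inv_mul_cancel₀ hv.ne']
  have hle : ENNReal.ofReal |α (((q v)⁻¹ • v : V) : A)| ≤ dualNorm q α :=
    le_iSup (fun v : {v : V // q v ≤ 1} => ENNReal.ofReal |α ((v : V) : A)|) ⟨_, hq⟩
  rw [ENNReal.ofReal_le_iff_le_toReal hfin] at hle
  have hsm : α (((q v)⁻¹ • v : V) : A) = (q v)⁻¹ * α (v : A) := map_smul α (q v)⁻¹ (v : A)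
  rw [hsm, abs_mul, abs_of_pos (inv_pos.2 hv), inv_mul_le_iff₀ hv] at hle
  linarith

theorem IsContinuousOn.sum_sq_le {q : Seminorm ℝ V} (hq : IsHilbertian q) {α : CharSpace A}
    (h : IsContinuousOn q α) {E : Finset V} (hE : IsFON q E) :
    ∑ e ∈ E, α (e : A) ^ 2 ≤ (dualNorm q α).toReal ^ 2 := by
  obtain ⟨B, hs, h0, hB⟩ := hq
  have hON : IsON B E := by
    refine ⟨fun e he => ?_, fun e he f hf hef => ?_⟩
    · have := hE.1 e he
      rwa [hB, Real.sqrt_eq_one] at this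
    · rw [← polarForm_eq q B hs h0 hB]
      exact hE.2 e he f hf hef
  set s := ∑ e ∈ E, α (e : A) ^ 2 with hsdef
  have hs0 : 0 ≤ s := Finset.sum_nonneg fun e _ => sq_nonneg _
  have h1 := h.abs_le (∑ e ∈ E, α (e : A) • e)
  have h2 : α ((∑ e ∈ E, α (e : A) • e : V) : A) = s := by
    rw [AddSubmonoidClass.coe_finsetSum, map_sum, hsdef]
    refine Finset.sum_congr rfl fun e _ => ?_
    rw [Submodule.coe_smul, map_smul, smul_eq_mul, sq]
  rw [h2, hB, hON.apply_sum_smul_sum_smul (fun e => α (e : A)), abs_of_nonneg hs0] at h1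
  have h3 := Real.sq_sqrt hs0
  have h4 := Real.sqrt_nonneg s
  rcases h4.eq_or_lt with h5 | h5
  · rw [← h5] at h3
    nlinarith [sq_nonneg (dualNorm q α).toReal]
  · have h6 : Real.sqrt s ≤ (dualNorm q α).toReal := by
      refine le_of_mul_le_mul_right ?_ h5
      rwa [← sq, h3]
    rw [← h3]
    exact pow_le_pow_left₀ h4 h6 2

/-! ### The weighted covariance form -/

/-- The weight `(1 + ‖α‖²)⁻¹`. -/
noncomputable def dualWeight (q : Seminorm ℝ V) (α : CharSpace A) : ℝ :=
  (1 + (dualNorm q α).toReal ^ 2)⁻¹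

theorem dualWeight_pos (q : Seminorm ℝ V) (α : CharSpace A) : 0 < dualWeight q α := by
  unfold dualWeight; positivity

theorem dualWeight_le_one (q : Seminorm ℝ V) (α : CharSpace A) : dualWeight q α ≤ 1 :=
  inv_le_one_of_one_le₀ (by nlinarith [sq_nonneg (dualNorm q α).toReal])

theorem measurable_dualWeight (q : Seminorm ℝ V) :
    Measurable (dualWeight q : CharSpace A → ℝ) :=
  (((measurable_dualNorm q).ennreal_toReal.pow_const 2).const_add 1).inv

theorem IsRepresenting.integrable_weight {L : A →ₗ[ℝ] ℝ} {ν : Measure (CharSpace A)}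
    (h : IsRepresenting L ν) (q : Seminorm ℝ V) (a b : A) :
    Integrable (fun α : CharSpace A => dualWeight q α * (α a * α b)) ν := by
  have hab : Integrable (fun α : CharSpace A => α a * α b) ν := by
    have := h.integrable (a * b)
    simpa only [map_mul] using this
  refine hab.bdd_mul (c := 1) (measurable_dualWeight q).aestronglyMeasurable
    (Eventually.of_forall fun α => ?_)
  rw [Real.norm_of_nonneg (dualWeight_pos q α).le]
  exact dualWeight_le_one q α

/-- The covariance form of `ν`, weighted by `(1 + ‖α‖²)⁻¹`. -/
noncomputable def covForm {L : A →ₗ[ℝ] ℝ} {ν : Measure (CharSpace A)}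
    (h : IsRepresenting L ν) (q : Seminorm ℝ V) : V →ₗ[ℝ] V →ₗ[ℝ] ℝ :=
  LinearMap.mk₂ ℝ (fun v w : V => ∫ α : CharSpace A, dualWeight q α * (α (v : A) * α (w : A)) ∂ν)
    (fun v v' w => by
      rw [← integral_add (h.integrable_weight q _ _) (h.integrable_weight q _ _)]
      refine integral_congr_ae (Eventually.of_forall fun α => ?_)
      simp only [Submodule.coe_add, map_add]
      ring)
    (fun r v w => by
      rw [← integral_smul]
      refine integral_congr_ae (Eventually.of_forall fun α => ?_)
      simp only [Submodule.coe_smul, map_smul, smul_eq_mul]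
      ring)
    (fun v w w' => by
      rw [← integral_add (h.integrable_weight q _ _) (h.integrable_weight q _ _)]
      refine integral_congr_ae (Eventually.of_forall fun α => ?_)
      simp only [Submodule.coe_add, map_add]
      ring)
    (fun r v w => by
      rw [← integral_smul]
      refine integral_congr_ae (Eventually.of_forall fun α => ?_)
      simp only [Submodule.coe_smul, map_smul, smul_eq_mul]
      ring)

theorem covForm_self {L : A →ₗ[ℝ] ℝ} {ν : Measure (CharSpace A)} (h : IsRepresenting L ν)
    (q : Seminorm ℝ V) (v : V) :
    covForm h q v v = ∫ α : CharSpace A, dualWeight q α * (α (v : A) * α (v : A)) ∂ν := rfl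

theorem covForm_comm {L : A →ₗ[ℝ] ℝ} {ν : Measure (CharSpace A)} (h : IsRepresenting L ν)
    (q : Seminorm ℝ V) (v w : V) : covForm h q v w = covForm h q w v :=
  integral_congr_ae (Eventually.of_forall fun α => by
    change dualWeight q α * (α (v : A) * α (w : A)) = dualWeight q α * (α (w : A) * α (v : A))
    ring)

theorem covForm_nonneg {L : A →ₗ[ℝ] ℝ} {ν : Measure (CharSpace A)} (h : IsRepresenting L ν)
    (q : Seminorm ℝ V) (v : V) : 0 ≤ covForm h q v v :=
  integral_nonneg fun α => mul_nonneg (dualWeight_pos q α).le (mul_self_nonneg _)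

/-- The Hilbertian seminorm of the weighted covariance form. -/
noncomputable def covSeminorm {L : A →ₗ[ℝ] ℝ} {ν : Measure (CharSpace A)}
    (h : IsRepresenting L ν) (q : Seminorm ℝ V) : Seminorm ℝ V :=
  formSeminorm (covForm h q) (covForm_comm h q) (covForm_nonneg h q)

theorem covSeminorm_apply {L : A →ₗ[ℝ] ℝ} {ν : Measure (CharSpace A)}
    (h : IsRepresenting L ν) (q : Seminorm ℝ V) (v : V) :
    covSeminorm h q v = Real.sqrt (covForm h q v v) := rfl

theorem covSeminorm_sq {L : A →ₗ[ℝ] ℝ} {ν : Measure (CharSpace A)}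
    (h : IsRepresenting L ν) (q : Seminorm ℝ V) (v : V) :
    covSeminorm h q v ^ 2 = covForm h q v v :=
  Real.sq_sqrt (covForm_nonneg h q v)

theorem isHilbertian_covSeminorm {L : A →ₗ[ℝ] ℝ} {ν : Measure (CharSpace A)}
    (h : IsRepresenting L ν) (q : Seminorm ℝ V) : IsHilbertian (covSeminorm h q) :=
  ⟨covForm h q, covForm_comm h q, covForm_nonneg h q, fun _ => rfl⟩

theorem seminormTrace_covSeminorm_lt_top {L : A →ₗ[ℝ] ℝ} {ν : Measure (CharSpace A)}
    [IsProbabilityMeasure ν] (h : IsRepresenting L ν) {q : Seminorm ℝ V} (hq : IsHilbertian q)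
    (hν : ∀ᵐ α ∂ν, IsContinuousOn q α) : seminormTrace (covSeminorm h q) q < ∞ := by
  have hker : ∀ v, q v = 0 → covSeminorm h q v = 0 := fun v hv => by
    rw [covSeminorm_apply, covForm_self, integral_eq_zero_of_ae, Real.sqrt_zero]
    filter_upwards [hν] with α hα
    have := hα.abs_le v
    rw [hv, mul_zero, abs_nonpos_iff] at this
    simp [this]
  rw [seminormTrace, if_pos hker]
  refine lt_of_le_of_lt (iSup₂_le fun E hE => ?_) ENNReal.one_lt_top
  rw [← ENNReal.ofReal_sum_of_nonneg fun _ _ => sq_nonneg _, ← ENNReal.ofReal_one]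
  refine ENNReal.ofReal_le_ofReal ?_
  simp only [covSeminorm_sq, covForm_self]
  rw [← integral_finsetSum _ fun e _ => h.integrable_weight q _ _]
  have h1 : ∫ _ : CharSpace A, (1 : ℝ) ∂ν = 1 := by simp
  rw [← h1]
  refine integral_mono_ae (integrable_finsetSum _ fun e _ => h.integrable_weight q _ _)
    (integrable_const _) ?_
  filter_upwards [hν] with α hα
  have h2 := hα.sum_sq_le hq hE
  simp only [← Finset.mul_sum, ← sq]
  rw [dualWeight, inv_mul_le_iff₀ (by positivity)]
  linarith

theorem exists_covSeminorm_le {L : A →ₗ[ℝ] ℝ} {ν : Measure (CharSpace A)}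
    [IsProbabilityMeasure ν] (h : IsRepresenting L ν) (q : Seminorm ℝ V) {ε : ℝ} (hε : 0 < ε) :
    ∃ δ : ℝ, 0 < δ ∧ ∀ v : V, covSeminorm h q v ≤ δ →
      ν {α : CharSpace A | 1 ≤ |α (v : A)|} ≤ ENNReal.ofReal ε := by
  have hmeas : Measurable fun α : CharSpace A => (dualNorm q α).toReal :=
    (measurable_dualNorm q).ennreal_toReal
  have hlim : Tendsto (fun n : ℕ => ν {α : CharSpace A | (n : ℝ) ≤ (dualNorm q α).toReal}) atTop
      (𝓝 0) := by
    have hempty : ⋂ n : ℕ, {α : CharSpace A | (n : ℝ) ≤ (dualNorm q α).toReal} = ∅ := by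
      refine Set.eq_empty_iff_forall_notMem.2 fun α hα => ?_
      obtain ⟨n, hn⟩ := exists_nat_gt (dualNorm q α).toReal
      exact absurd (Set.mem_iInter.1 hα n) (not_le.2 hn)
    have := tendsto_measure_iInter_atTop (μ := ν)
      (s := fun n : ℕ => {α : CharSpace A | (n : ℝ) ≤ (dualNorm q α).toReal})
      (fun n => (measurableSet_le measurable_const hmeas).nullMeasurableSet)
      (fun i j hij α hα => le_trans (b := (j : ℝ)) (Nat.cast_le.2 hij) hα) ⟨0, measure_ne_top _ _⟩
    rwa [hempty, measure_empty] at this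
  obtain ⟨n, hn⟩ := (hlim.eventually (ge_mem_nhds
    (ENNReal.ofReal_pos.2 (half_pos hε)))).exists
  have hpos : (0 : ℝ) < 1 + (n : ℝ) ^ 2 := by positivity
  refine ⟨Real.sqrt (ε / 2 / (1 + (n : ℝ) ^ 2)), Real.sqrt_pos.2 (by positivity), fun v hv => ?_⟩
  have hform : covForm h q v v ≤ ε / 2 / (1 + (n : ℝ) ^ 2) := by
    rw [covSeminorm_apply] at hv
    exact (Real.sqrt_le_sqrt_iff (by positivity)).1 hv
  have hmarkov := mul_meas_ge_le_integral_of_nonneg (μ := ν)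
    (Eventually.of_forall fun α => mul_nonneg (dualWeight_pos q α).le (mul_self_nonneg _))
    (h.integrable_weight q (v : A) (v : A)) (1 + (n : ℝ) ^ 2)⁻¹
  have hsub : {α : CharSpace A | 1 ≤ |α (v : A)|} ⊆
      {α : CharSpace A | (n : ℝ) ≤ (dualNorm q α).toReal} ∪
        {α | (1 + (n : ℝ) ^ 2)⁻¹ ≤ dualWeight q α * (α (v : A) * α (v : A))} := by
    intro α hα
    by_cases hnα : (n : ℝ) ≤ (dualNorm q α).toReal
    · exact Or.inl hnα
    · refine Or.inr ?_
      have h1 : (1 : ℝ) ≤ α (v : A) * α (v : A) := by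
        rw [← abs_mul_abs_self]
        exact one_le_mul_of_one_le_of_one_le hα hα
      have h2 : (1 + (n : ℝ) ^ 2)⁻¹ ≤ dualWeight q α := by
        refine inv_anti₀ (by positivity) ?_
        have := pow_le_pow_left₀ ENNReal.toReal_nonneg (not_le.1 hnα).le 2
        linarith
      exact h2.trans (le_mul_of_one_le_right (dualWeight_pos q α).le h1)
  refine (measure_mono hsub).trans ((measure_union_le _ _).trans ?_)
  rw [← add_halves ε, ENNReal.ofReal_add (half_pos hε).le (half_pos hε).le]
  refine add_le_add hn ?_
  rw [← covForm_self h q v, inv_mul_le_iff₀ hpos] at hmarkov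
  rw [← ENNReal.ofReal_toReal (measure_ne_top ν _)]
  refine ENNReal.ofReal_le_ofReal (hmarkov.trans ?_)
  rwa [le_div_iff₀ hpos, mul_comm] at hform

end Restriction

end MomentProblem

theorem mainTheorem4 {A : Type*} [CommRing A] [Algebra ℝ A]
    (V : Submodule ℝ A) (hV : Algebra.adjoin ℝ (V : Set A) = ⊤)
    (K : Set (MomentProblem.CharSpace A)) (hK : IsClosed K)
    (q : Seminorm ℝ V) (hq : MomentProblem.IsHilbertian q)
    (hne : {α ∈ K | MomentProblem.IsContinuousOn q α}.Nonempty)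
    (L : A →ₗ[ℝ] ℝ) (hL : L 1 = 1)
    (Q : Set A) (hQ : MomentProblem.IsQuadraticModule Q)
    (hKQ : K = MomentProblem.nonnegSet Q) :
    (∃ ν : Measure (MomentProblem.CharSpace A),
        MomentProblem.IsRepresenting L ν ∧
        MomentProblem.IsSupportedIn ν {α ∈ K | MomentProblem.IsContinuousOn q α}) ↔
      ∃ p : Seminorm ℝ V, MomentProblem.IsHilbertian p ∧
        MomentProblem.seminormTrace p q < ∞ ∧
        ∃ ν : ∀ S : MomentProblem.finGenSubalgebras V,
            Measure (MomentProblem.CharSpace (S : Subalgebra ℝ A)),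
          (∀ S : MomentProblem.finGenSubalgebras V,
            MomentProblem.IsRepresenting (L ∘ₗ (S : Subalgebra ℝ A).val.toLinearMap) (ν S) ∧
            MomentProblem.IsSupportedIn (ν S)
              (MomentProblem.nonnegSet {a : (S : Subalgebra ℝ A) | (a : A) ∈ Q})) ∧
          MomentProblem.IsConcentrated p ν := by
  subst hKQ
  constructor
  · rintro ⟨ν, hrep, hsupp⟩
    have := hrep.isProbabilityMeasure hL
    have hae : ∀ᵐ α ∂ν, α ∈ {α ∈ MomentProblem.nonnegSet Q | MomentProblem.IsContinuousOn q α} :=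
      mem_ae_iff.2 hsupp
    have hK' : MomentProblem.IsSupportedIn ν (MomentProblem.nonnegSet Q) :=
      mem_ae_iff.1 (hae.mono fun α hα => hα.1)
    refine ⟨MomentProblem.covSeminorm hrep q, MomentProblem.isHilbertian_covSeminorm hrep q,
      MomentProblem.seminormTrace_covSeminorm_lt_top hrep hq (hae.mono fun α hα => hα.2),
      fun S => ν.map (MomentProblem.CharSpace.comp (S : Subalgebra ℝ A).val),
      fun S => ⟨hrep.map_comp _, hK'.map_comp _⟩, fun ε hε => ?_⟩
    obtain ⟨δ, hδ, h⟩ := MomentProblem.exists_covSeminorm_le hrep q hε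
    refine ⟨δ, hδ, fun S a ha haS => ?_⟩
    rw [Measure.map_apply (MomentProblem.CharSpace.continuous_comp _).measurable
      (measurableSet_le measurable_const (MomentProblem.CharSpace.measurable_eval _).abs)]
    exact h a ha
  · rintro ⟨p, hp, hpq, ν, hν, hconc⟩
    exact MomentProblem.exists_representing_of_concentrated hV hq hL hQ hp hpq
      (fun S => (hν S).1) (fun S => (hν S).2) hconc
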